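/- Let $\log$ denote the natural logarithm. For $n\in\mathbb{N}$ let $M_n$ be chosen uniformly at random from the set of all symmetric $n\times n$ matrices with entries in $\{1,-1\}$. For a vector $a=(a_1,\dots,a_n)\in\mathbb{Z}^n$ and $0\le\mu\le 1$, the $\mu$-atom probability of $a$ is $$\rho_\mu(a)=\sup_{c\in\mathbb{Z}}\Pr\left[a_1x_1^{\mu}+\dots+a_nx_n^{\mu}=c\right],$$ where $x_1^\mu,\dots,x_n^\mu$ are i.i.d. random variables taking the value $0$ with probability $\mu$ and the values $1$ and $-1$ with probability $(1-\mu)/2$ each. **Theorem 3.2.** Let $\alpha(n)=2^{-n^{1/4}\sqrt{\log n}/64}$ and $\beta(n)=n^{-3/4}\sqrt{\log n}/128$. For $0\le\alpha,\beta\le 1$ let $\mathrm{Orth}_{\alpha,\beta n}(n)$ be the event that every non-zero vector $a\in\mathbb{Z}^n$ which is orthogonal to at least $(1-\beta)n$ of the rows of $M_n$ satisfies $\rho_\mu(a)\le\alpha$ for all $0\le\mu\le 1/2$. Then there is an $N\in\mathbb{N}$ such that for all $n\ge N$, with $\alpha=\alpha(n)$ and $\beta=\beta(n)$, $$\Pr\left[\overline{\mathrm{Orth}_{\alpha,\beta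 n}(n)}\right]\le 2^{-n/32}.$$ -/

import Mathlib

/-- The probability that a lazy random sign `x^μ` takes a given value in `{-1, 0, 1}`: the value `0`
has probability `μ`, and `1` and `-1` have probability `(1 - μ) / 2` each. -/
noncomputable def lazySignWeight (μ : ℝ) (s : SignType) : ℝ :=
  if s = 0 then μ else (1 - μ) / 2

/-- `Pr[a₁ x₁^μ + ⋯ + aₙ xₙ^μ = c]` for i.i.d. lazy random signs `x₁^μ, …, xₙ^μ`: the total product
weight of all outcomes `x ∈ {-1, 0, 1}ⁿ` with `∑ aᵢ xᵢ = c`. -/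
noncomputable def probLinearFormEq {R : Type*} [Ring R] [DecidableEq R] {n : ℕ} (μ : ℝ)
    (a : Fin n → R) (c : R) : ℝ :=
  ∑ x : Fin n → SignType with ∑ i, a i * (x i : R) = c, ∏ i, lazySignWeight μ (x i)

/-- The `μ`-atom probability of `a ∈ Rⁿ`: the supremum over `c ∈ R` of
`Pr[a₁ x₁^μ + ⋯ + aₙ xₙ^μ = c]`. -/
noncomputable def atomProb {R : Type*} [Ring R] [DecidableEq R] {n : ℕ} (μ : ℝ)
    (a : Fin n → R) : ℝ :=
  ⨆ c : R, probLinearFormEq μ a c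

/-- The set of all symmetric `n × n` matrices with entries `1` and `-1`. The random matrix `Mₙ` is
uniformly distributed on this (finite, non-empty) set. -/
def symSignMatrices (n : ℕ) : Set (Matrix (Fin n) (Fin n) ℤ) :=
  {M | M.IsSymm ∧ ∀ i j, M i j = 1 ∨ M i j = -1}

/-- `Pr[Mₙ ∈ E]` for `Mₙ` uniformly distributed on the symmetric `n × n` matrices with entries
`1` and `-1`: the proportion of these matrices that lie in `E`. -/
noncomputable def probSymSign (n : ℕ) (E : Set (Matrix (Fin n) (Fin n) ℤ)) : ℝ :=
  ((symSignMatrices n ∩ E).ncard : ℝ) / ((symSignMatrices n).ncard : ℝ)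

/-- The number of rows of `M` that are orthogonal to `a`. -/
def numOrthRows {n : ℕ} (M : Matrix (Fin n) (Fin n) ℤ) (a : Fin n → ℤ) : ℕ :=
  (Finset.univ.filter fun i => M i ⬝ᵥ a = 0).card

/-- The event that every non-zero integer vector orthogonal to at least `(1 - β) n` rows of the
`n × n` matrix has `μ`-atom probability (in `ℤ`) at most `α`, for all `0 ≤ μ ≤ 1/2`. -/
def orthEvent (n : ℕ) (α β : ℝ) : Set (Matrix (Fin n) (Fin n) ℤ) :=
  {M | ∀ a : Fin n → ℤ, a ≠ 0 → (1 - β) * (n : ℝ) ≤ (numOrthRows M a : ℝ) →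
    ∀ μ : ℝ, 0 ≤ μ → μ ≤ 1 / 2 → atomProb μ a ≤ α}

/-!
An integer vector that violates the event is divided by the gcd of its entries and reduced modulo a
prime `p` of size about `2 ^ n ^ (3 / 10)`, far larger than `1 / α` (`exists_zmod_vector`). The
result is a non-zero vector `b` modulo `p` which is orthogonal to all but few rows and all of whose
subvectors have large concentration probability; a union bound over such `b` proves the theorem.

For a fixed `b` and a set `S` of indices, the `S`-parts of the rows outside `S` are independent, in
spite of the symmetry. Hence the probability that they are orthogonal to `b` is at most `ρ` to the
number of rows, for `ρ` the concentration probability of `b` restricted to `S`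
(`card_orth_rows_le`). If `b` has few non-zero entries, a single such entry and `ρ = 1 / 2` suffice,
because there are few vectors of this kind.

Otherwise Halász's inequality (`sum_exp_le_relations`) compares `ρ` with the number of signed
relations `± b_{i₁} ± ⋯ ± b_{i₂ₖ} = 0` with indices in `S`, divided by `W (2 |S|) ^ (2 k)`. It
results from Fourier inversion, from the growth of Bohr sets by the Cauchy–Davenport theorem
(`min_le_card_bohrSet`), and from a bound for Bohr sets by moments of cosine sums. As the
concentration probabilities of `b` are large, most of the relations have an index of multiplicity
one (`card_not_hasUniqueIndex_le`, `fourierBound_le_uniqueRelations`). Each such relation determines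
one entry of `b` by the others, so that vectors with many relations in every `s`-element subset of
their support are rare. In weighted form (`sum_minRelations_pow_le`) this count cancels the
probabilities `ρ ^ n` up to a factor `2 ^ O(n)`, apart from the gain `W ^ (-n)` of Halász's
inequality, where `W` is a power of `n`. All parameters are powers of `u ≈ n ^ (1 / 20)`
(`union_bound_le`).
-/

/-! ### Fourier bounds for concentration probabilities -/

section

open Finset ZMod

theorem AddChar.map_sum_prod {G R ι : Type*} [AddCommMonoid G] [CommMonoid R] (ψ : AddChar G R)
    (s : Finset ι) (f : ι → G) : ψ (∑ i ∈ s, f i) = ∏ i ∈ s, ψ (f i) := by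
  classical
  induction s using Finset.induction_on with
  | empty => simp
  | insert i s hi ih => rw [sum_insert hi, prod_insert hi, AddChar.map_add_eq_mul, ih]

/-- Fourier inversion on `ℤ/p`: a product measure gives each level set of a sum of independent
`ℤ/p`-valued variables at most the average absolute value of the characteristic function. -/
theorem sum_prod_weight_le_fourier {p : ℕ} [Fact p.Prime] {ι σ : Type*} [Fintype ι]
    [DecidableEq ι] [Fintype σ] (w : σ → ℝ) (v : ι → σ → ZMod p) (c : ZMod p) :
    ∑ x : ι → σ with ∑ i, v i (x i) = c, ∏ i, w (x i) ≤
      (p : ℝ)⁻¹ * ∑ r : ZMod p, ∏ i, ‖∑ t, (w t : ℂ) * stdAddChar (v i t * r)‖ := by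
  have hp : (p : ℂ) ≠ 0 := by exact_mod_cast (Fact.out : p.Prime).ne_zero
  have key : ((∑ x : ι → σ with ∑ i, v i (x i) = c, ∏ i, w (x i) : ℝ) : ℂ) =
      (p : ℂ)⁻¹ * ∑ r : ZMod p, stdAddChar (-(c * r)) *
        ∏ i, ∑ t, (w t : ℂ) * stdAddChar (v i t * r) := by
    have h1 : ∀ r : ZMod p, stdAddChar (-(c * r)) *
        ∏ i, ∑ t, (w t : ℂ) * stdAddChar (v i t * r) =
        ∑ x : ι → σ, (∏ i, (w (x i) : ℂ)) * stdAddChar (r * (∑ i, v i (x i) - c)) := by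
      intro r
      rw [prod_univ_sum, mul_sum, Fintype.piFinset_univ]
      refine sum_congr rfl fun x _ => ?_
      have : r * (∑ i, v i (x i) - c) = -(c * r) + ∑ i, v i (x i) * r := by
        rw [← sum_mul]; ring
      rw [this, AddChar.map_add_eq_mul, AddChar.map_sum_prod, prod_mul_distrib]
      ring
    simp_rw [h1]
    rw [sum_comm]
    simp_rw [← mul_sum, AddChar.sum_mulShift _ (isPrimitive_stdAddChar p), sub_eq_zero, ZMod.card]
    rw [Complex.ofReal_sum, sum_filter, mul_sum]
    refine sum_congr rfl fun x _ => ?_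
    split_ifs
    · push_cast; field_simp
    · simp
  have h2 : ∑ x : ι → σ with ∑ i, v i (x i) = c, ∏ i, w (x i) ≤
      ‖((∑ x : ι → σ with ∑ i, v i (x i) = c, ∏ i, w (x i) : ℝ) : ℂ)‖ := by
    rw [Complex.norm_real]; exact le_abs_self _
  refine h2.trans ?_
  rw [key, norm_mul, norm_inv, Complex.norm_natCast]
  gcongr
  refine (norm_sum_le _ _).trans (sum_le_sum fun r _ => ?_)
  rw [norm_mul, AddChar.norm_apply, one_mul, norm_prod]

/-- The characteristic function of a lazy random sign of laziness `μ ≤ 1/2` decays with the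
distance of the *square* of the phase from `1`, because near the phase `-1` it need not decay. -/
theorem abs_lazy_charFun_le {μ : ℝ} (h0 : 0 ≤ μ) (h1 : μ ≤ 1 / 2) {z : ℂ} (hz : ‖z‖ = 1) :
    |μ + (1 - μ) * z.re| ≤ Real.exp (-‖1 - z ^ 2‖ ^ 2 / 16) := by
  have hz2 : z.re ^ 2 + z.im ^ 2 = 1 := by
    have := Complex.sq_norm z
    rw [hz, Complex.normSq_apply] at this; nlinarith
  have hn : ‖1 - z ^ 2‖ ^ 2 = 4 * (1 - z.re ^ 2) := by
    rw [Complex.sq_norm, Complex.normSq_apply]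
    simp only [Complex.sub_re, Complex.sub_im, Complex.one_re, Complex.one_im, pow_two,
      Complex.mul_re, Complex.mul_im]
    have : z.im * z.im = 1 - z.re * z.re := by nlinarith
    linear_combination (z.im * z.im + 3 + z.re * z.re) * this
  have hc : |z.re| ≤ 1 := hz ▸ Complex.abs_re_le_norm z
  have hca : z.re ^ 2 = |z.re| ^ 2 := (sq_abs _).symm
  rw [hn]
  have hexp := Real.add_one_le_exp (-(4 * (1 - z.re ^ 2)) / 16)
  refine le_trans ?_ hexp
  have hc0 := abs_nonneg z.re
  have e1 := le_abs_self z.re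
  have e2 := neg_abs_le z.re
  rw [hca]
  rw [abs_le]
  constructor <;> nlinarith

/-- The squared Euclidean distance of the phases `(e(aⱼ r / p))_{j ∈ S}` from `(1, …, 1)`. -/
noncomputable def phaseDeviation {p : ℕ} [NeZero p] {ι : Type*} (S : Finset ι) (a : ι → ZMod p)
    (r : ZMod p) : ℝ :=
  ∑ j ∈ S, ‖1 - (stdAddChar (a j * r) : ℂ)‖ ^ 2

theorem phaseDeviation_nonneg {p : ℕ} [NeZero p] {ι : Type*} (S : Finset ι) (a : ι → ZMod p)
    (r : ZMod p) : 0 ≤ phaseDeviation S a r :=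
  sum_nonneg fun _ _ => by positivity

theorem sum_prod_exp_le {p : ℕ} [Fact p.Prime] (hp2 : p ≠ 2) {ι : Type*} [Fintype ι]
    (S : Finset ι) (a : ι → ZMod p) (F : ι → ZMod p → ℝ) (h0 : ∀ i r, 0 ≤ F i r)
    (h1 : ∀ i r, F i r ≤ 1)
    (hS : ∀ i ∈ S, ∀ r, F i r ≤ Real.exp (-‖1 - (stdAddChar (a i * r) : ℂ) ^ 2‖ ^ 2 / 16)) :
    ∑ r, ∏ i, F i r ≤ ∑ r, Real.exp (-phaseDeviation S a r / 16) := by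
  classical
  have h2 : (2 : ZMod p) ≠ 0 := by
    intro h
    have : ((2 : ℕ) : ZMod p) = 0 := by exact_mod_cast h
    rw [ZMod.natCast_eq_zero_iff] at this
    exact hp2 ((Nat.prime_dvd_prime_iff_eq Fact.out Nat.prime_two).1 this)
  rw [← Equiv.sum_comp (Equiv.mulLeft₀ (2 : ZMod p) h2)
    (fun r => Real.exp (-phaseDeviation S a r / 16))]
  refine sum_le_sum fun r _ => ?_
  calc ∏ i, F i r ≤ ∏ i ∈ S, F i r := by
        rw [← prod_sdiff (subset_univ S)]
        exact mul_le_of_le_one_left (prod_nonneg fun i _ => h0 i r)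
          (prod_le_one (fun i _ => h0 i r) fun i _ => h1 i r)
    _ ≤ ∏ i ∈ S, Real.exp (-‖1 - (stdAddChar (a i * r) : ℂ) ^ 2‖ ^ 2 / 16) :=
        prod_le_prod (fun i _ => h0 i r) fun i hi => hS i hi r
    _ = _ := by
        rw [← Real.exp_sum, phaseDeviation, ← sum_div, sum_neg_distrib]
        congr 3
        refine sum_congr rfl fun i _ => ?_
        rw [← AddChar.map_nsmul_eq_pow]
        congr 4
        simp [mul_left_comm, two_mul]

theorem stdAddChar_add_neg {p : ℕ} [Fact p.Prime] (x : ZMod p) :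
    (stdAddChar x : ℂ) + stdAddChar (-x) = ((2 * (stdAddChar x : ℂ).re : ℝ) : ℂ) := by
  rw [AddChar.map_neg_eq_conj, Complex.add_conj]

theorem probLinearFormEq_le_exp {p n : ℕ} [Fact p.Prime] (hp2 : p ≠ 2) {μ : ℝ} (h0 : 0 ≤ μ)
    (h1 : μ ≤ 1 / 2) (a : Fin n → ZMod p) (S : Finset (Fin n)) (c : ZMod p) :
    probLinearFormEq μ a c ≤
      (p : ℝ)⁻¹ * ∑ r, Real.exp (-phaseDeviation S a r / 16) := by
  have hchar : ∀ i r, ‖∑ t : SignType, (lazySignWeight μ t : ℂ) *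
      stdAddChar (a i * (t : ZMod p) * r)‖ = |μ + (1 - μ) * (stdAddChar (a i * r) : ℂ).re| := by
    intro i r
    have hu : (Finset.univ : Finset SignType) = {0, -1, 1} := by decide
    rw [hu, sum_insert (by decide), sum_insert (by decide), sum_singleton, ← Real.norm_eq_abs, ← Complex.norm_real]
    congr 1
    have := stdAddChar_add_neg (a i * r)
    simp only [lazySignWeight, SignType.coe_zero, SignType.coe_one, SignType.coe_neg,
      mul_zero, zero_mul, AddChar.map_zero_eq_one, mul_one, mul_neg, neg_mul]
    simp only [if_true, show (-1 : SignType) ≠ 0 by decide, show (1 : SignType) ≠ 0 by decide,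
      if_false]
    push_cast at this ⊢
    linear_combination (1 - (μ : ℂ)) / 2 * this
  refine (sum_prod_weight_le_fourier (lazySignWeight μ) (fun i t => a i * (t : ZMod p)) c).trans ?_
  refine mul_le_mul_of_nonneg_left ?_ (by positivity)
  simp_rw [hchar]
  have hb := fun i r => abs_lazy_charFun_le h0 h1 (AddChar.norm_apply stdAddChar (a i * r))
  refine sum_prod_exp_le hp2 S a _ (fun _ _ => abs_nonneg _) (fun i r => (hb i r).trans ?_)
    (fun i _ r => hb i r)
  rw [Real.exp_le_one_iff]
  have := sq_nonneg ‖1 - (stdAddChar (a i * r) : ℂ) ^ 2‖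
  linarith

/-- The fraction of sign vectors for which the partial linear form over `S` takes the value `c`. -/
theorem card_sign_le_exp {p : ℕ} [Fact p.Prime] (hp2 : p ≠ 2) {ι : Type*} [Fintype ι]
    [DecidableEq ι] (a : ι → ZMod p) (S : Finset ι) (c : ZMod p) :
    (#{y : ι → ℤˣ | ∑ j ∈ S, a j * ((y j : ℤ) : ZMod p) = c} : ℝ) ≤
      ((p : ℝ)⁻¹ * ∑ r, Real.exp (-phaseDeviation S a r / 16)) * 2 ^ Fintype.card ι := by
  have hu : (Finset.univ : Finset ℤˣ) = {1, -1} := by decide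
  set v : ι → ℤˣ → ZMod p := fun i t => if i ∈ S then a i * ((t : ℤ) : ZMod p) else 0
  have hchar : ∀ i r, ‖∑ t : ℤˣ, ((1 / 2 : ℝ) : ℂ) * stdAddChar (v i t * r)‖ =
      if i ∈ S then |(stdAddChar (a i * r) : ℂ).re| else 1 := by
    intro i r
    rw [hu, sum_insert (by decide), sum_singleton]
    split_ifs with hi
    · rw [← Real.norm_eq_abs, ← Complex.norm_real]
      congr 1
      have := stdAddChar_add_neg (a i * r)
      simp only [v, hi, if_true, Units.val_one, Units.val_neg, Int.cast_one, Int.cast_neg,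
        mul_one, mul_neg, neg_mul]
      push_cast at this ⊢
      linear_combination (1 / 2) * this
    · simp only [v, hi, if_false, zero_mul, AddChar.map_zero_eq_one]
      norm_num
  have h := sum_prod_weight_le_fourier (fun _ : ℤˣ => (1 / 2 : ℝ)) v c
  simp_rw [hchar] at h
  have hb := fun i r => abs_lazy_charFun_le le_rfl (by norm_num)
    (AddChar.norm_apply (stdAddChar (N := p)) (a i * r))
  simp only [sub_zero, one_mul, zero_add] at hb
  have h' := sum_prod_exp_le hp2 S a
    (fun i r => if i ∈ S then |(stdAddChar (a i * r) : ℂ).re| else 1)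
    (fun i r => by positivity) (fun i r => by
      split_ifs
      · exact (Complex.abs_re_le_norm _).trans_eq (AddChar.norm_apply _ _)
      · exact le_rfl) (fun i hi r => by simpa only [hi, if_true] using hb i r)
  have h3 := h.trans (mul_le_mul_of_nonneg_left h' (by positivity))
  simp only [prod_const, card_univ, sum_const, nsmul_eq_mul, v] at h3
  have hset : ∀ y : ι → ℤˣ, (∑ i, if i ∈ S then a i * ((y i : ℤ) : ZMod p) else 0) =
      ∑ j ∈ S, a j * ((y j : ℤ) : ZMod p) := fun y => by
    rw [← sum_filter]; congr 1; ext; simp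
  simp_rw [hset] at h3
  rw [one_div, inv_pow, ← div_eq_mul_inv, div_le_iff₀ (by positivity)] at h3
  exact h3

end

/-! ### Halász's inequality on `ℤ/p` -/

section

open Finset ZMod

theorem sum_stdAddChar_mul {p : ℕ} [Fact p.Prime] {b : ZMod p} (hb : b ≠ 0) :
    ∑ r : ZMod p, (stdAddChar (b * r) : ℂ) = 0 := by
  have := AddChar.sum_mulShift b (isPrimitive_stdAddChar p)
  simp_rw [mul_comm b]
  simpa [hb] using this

theorem phaseDeviation_eq {p : ℕ} [Fact p.Prime] {ι : Type*} (S : Finset ι) (a : ι → ZMod p)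
    (r : ZMod p) :
    phaseDeviation S a r = 2 * #S - ∑ j ∈ S, 2 * (stdAddChar (a j * r) : ℂ).re := by
  have h : ∀ z : ℂ, ‖z‖ = 1 → ‖1 - z‖ ^ 2 = 2 - 2 * z.re := by
    intro z hz
    have h1 := Complex.sq_norm z
    rw [hz, Complex.normSq_apply] at h1
    rw [Complex.sq_norm, Complex.normSq_apply]
    simp only [Complex.sub_re, Complex.sub_im, Complex.one_re, Complex.one_im]
    linarith
  rw [phaseDeviation, sum_congr rfl fun j _ => h _ (AddChar.norm_apply stdAddChar (a j * r)),
    sum_sub_distrib, sum_const, nsmul_eq_mul]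
  ring

theorem sum_phaseDeviation {p : ℕ} [Fact p.Prime] {ι : Type*} {S : Finset ι} {a : ι → ZMod p}
    (ha : ∀ j ∈ S, a j ≠ 0) : ∑ r, phaseDeviation S a r = 2 * #S * p := by
  simp_rw [phaseDeviation_eq, sum_sub_distrib]
  rw [sum_comm, sum_eq_zero (s := S)]
  · simp [ZMod.card]; ring
  · intro j hj
    rw [← mul_sum, ← Complex.re_sum, sum_stdAddChar_mul (ha j hj)]
    simp

theorem phaseDeviation_add_le {p : ℕ} [NeZero p] {ι : Type*} (S : Finset ι) (a : ι → ZMod p)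
    (r r' : ZMod p) {m : ℝ} (hm : 0 < m) :
    phaseDeviation S a (r + r') ≤
      (1 + 1 / m) * phaseDeviation S a r + (1 + m) * phaseDeviation S a r' := by
  unfold phaseDeviation
  rw [mul_sum, mul_sum, ← sum_add_distrib]
  refine sum_le_sum fun j _ => ?_
  rw [mul_add, AddChar.map_add_eq_mul]
  set z : ℂ := stdAddChar (a j * r)
  set w : ℂ := stdAddChar (a j * r')
  have hz : ‖z‖ = 1 := AddChar.norm_apply _ _
  have h : ‖1 - z * w‖ ≤ ‖1 - z‖ + ‖1 - w‖ := by
    have : 1 - z * w = (1 - z) + z * (1 - w) := by ring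
    rw [this]
    refine (norm_add_le _ _).trans ?_
    rw [norm_mul, hz, one_mul]
  have h0 := norm_nonneg (1 - z * w)
  set x := ‖1 - z‖
  set y := ‖1 - w‖
  have h2 : ‖1 - z * w‖ ^ 2 ≤ (x + y) ^ 2 := by gcongr
  refine h2.trans ?_
  have h3 : (1 + 1 / m) * x ^ 2 + (1 + m) * y ^ 2 - (x + y) ^ 2 = (x - m * y) ^ 2 / m := by
    field_simp; ring
  have : 0 ≤ (x - m * y) ^ 2 / m := by positivity
  linarith

/-- The frequencies at which all phases are jointly within squared distance `l` of `1`. -/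
noncomputable def bohrSet {p : ℕ} [NeZero p] {ι : Type*} (S : Finset ι) (a : ι → ZMod p)
    (l : ℝ) : Finset (ZMod p) :=
  {r | phaseDeviation S a r ≤ l}

theorem mem_bohrSet {p : ℕ} [NeZero p] {ι : Type*} {S : Finset ι} {a : ι → ZMod p}
    {l : ℝ} {r : ZMod p} : r ∈ bohrSet S a l ↔ phaseDeviation S a r ≤ l := by
  simp [bohrSet]

theorem phaseDeviation_zero {p : ℕ} [NeZero p] {ι : Type*} (S : Finset ι) (a : ι → ZMod p) :
    phaseDeviation S a 0 = 0 := by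
  simp [phaseDeviation]

theorem zero_mem_bohrSet {p : ℕ} [NeZero p] {ι : Type*} {S : Finset ι} {a : ι → ZMod p}
    {l : ℝ} (hl : 0 ≤ l) : 0 ∈ bohrSet S a l := by
  rwa [mem_bohrSet, phaseDeviation_zero]

theorem bohrSet_mono {p : ℕ} [NeZero p] {ι : Type*} {S : Finset ι} {a : ι → ZMod p}
    {l l' : ℝ} (h : l ≤ l') : bohrSet S a l ⊆ bohrSet S a l' := fun r hr => by
  rw [mem_bohrSet] at *; exact hr.trans h

open scoped Pointwise in
/-- By Cauchy–Davenport, `m`-fold sumsets of a Bohr set, which lie in the Bohr set of `m²` times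
the radius, grow linearly. -/
theorem min_le_card_bohrSet {p : ℕ} [Fact p.Prime] {ι : Type*} (S : Finset ι) (a : ι → ZMod p)
    {l : ℝ} (hl : 0 ≤ l) (m : ℕ) (hm : 1 ≤ m) :
    min p (m * (#(bohrSet S a l) - 1) + 1) ≤ #(bohrSet S a (m ^ 2 * l)) := by
  have hc : 1 ≤ #(bohrSet S a l) := card_pos.2 ⟨0, zero_mem_bohrSet hl⟩
  induction m, hm using Nat.le_induction with
  | base =>
    refine (min_le_right _ _).trans ?_
    rw [Nat.cast_one, one_pow, one_mul, one_mul]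
    omega
  | succ m hm ih =>
    have hsub : bohrSet S a (m ^ 2 * l) + bohrSet S a l ⊆ bohrSet S a ((m + 1 : ℕ) ^ 2 * l) := by
      intro x hx
      obtain ⟨r, hr, r', hr', rfl⟩ := mem_add.1 hx
      rw [mem_bohrSet] at *
      have hm0 : (0 : ℝ) < m := by exact_mod_cast hm
      refine (phaseDeviation_add_le S a r r' hm0).trans ?_
      calc (1 + 1 / (m : ℝ)) * phaseDeviation S a r + (1 + m) * phaseDeviation S a r'
          ≤ (1 + 1 / (m : ℝ)) * (m ^ 2 * l) + (1 + m) * l := by gcongr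
        _ = _ := by push_cast; field_simp; ring
    have hcd := ZMod.cauchy_davenport (Fact.out : p.Prime)
      (s := bohrSet S a (m ^ 2 * l)) (t := bohrSet S a l)
      ⟨0, zero_mem_bohrSet (by positivity)⟩ ⟨0, zero_mem_bohrSet hl⟩
    have := card_le_card hsub
    have hexp : (m + 1) * (#(bohrSet S a l) - 1) = m * (#(bohrSet S a l) - 1) +
      (#(bohrSet S a l) - 1) := by ring
    omega

theorem card_bohrSet_lt {p : ℕ} [Fact p.Prime] {ι : Type*} {S : Finset ι} {a : ι → ZMod p}
    (ha : ∀ j ∈ S, a j ≠ 0) {l : ℝ} (hl : l < 2 * #S) : #(bohrSet S a l) < p := by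
  by_contra! h
  have huniv : bohrSet S a l = univ := by
    rw [← card_eq_iff_eq_univ, ZMod.card]
    exact le_antisymm ((card_le_univ _).trans_eq (ZMod.card p)) h
  have hp : (0 : ℝ) < p := by exact_mod_cast (Fact.out : p.Prime).pos
  have h1 : ∑ r, phaseDeviation S a r ≤ ∑ _r : ZMod p, l :=
    sum_le_sum fun r _ => mem_bohrSet.1 (huniv ▸ mem_univ r)
  rw [sum_phaseDeviation ha, sum_const, card_univ, ZMod.card, nsmul_eq_mul] at h1
  nlinarith

/-- Small Bohr sets are much smaller than the one of radius `W²`. -/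
theorem mul_card_bohrSet_le {p : ℕ} [Fact p.Prime] {ι : Type*} {S : Finset ι} {a : ι → ZMod p}
    (ha : ∀ j ∈ S, a j ≠ 0) {W : ℕ} (hW : W ^ 2 < 2 * #S) {l : ℕ} (hl : 1 ≤ l)
    (hlW : l ≤ W ^ 2) :
    W * (#(bohrSet S a l) - 1) ≤ 2 * l * #(bohrSet S a (W ^ 2 : ℕ)) := by
  have hN : #(bohrSet S a (W ^ 2 : ℕ)) < p := card_bohrSet_lt ha (by exact_mod_cast hW)
  rcases le_or_gt l W with h | h
  · have hm : 1 ≤ W / l := (Nat.one_le_div_iff hl).2 h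
    have h1 := min_le_card_bohrSet S a (Nat.cast_nonneg l) (W / l) hm
    have hml : W / l * l ≤ W := Nat.div_mul_le_self W l
    have hm2 : (W / l) ^ 2 * l ≤ W ^ 2 := by
      calc (W / l) ^ 2 * l = (W / l) * (W / l * l) := by ring
        _ ≤ W * W := Nat.mul_le_mul (Nat.div_le_self _ _) hml
        _ = _ := by ring
    have h2 : #(bohrSet S a (((W / l : ℕ) : ℝ) ^ 2 * (l : ℝ))) ≤ #(bohrSet S a (W ^ 2 : ℕ)) :=
      card_le_card (bohrSet_mono (by exact_mod_cast hm2))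
    have h3 : (W / l) * (#(bohrSet S a l) - 1) ≤ #(bohrSet S a (W ^ 2 : ℕ)) := by omega
    have h4 : W ≤ 2 * l * (W / l) := by
      have := Nat.lt_div_mul_add (a := W) hl
      nlinarith
    calc W * (#(bohrSet S a l) - 1) ≤ (2 * l * (W / l)) * (#(bohrSet S a l) - 1) := by gcongr
      _ = 2 * l * ((W / l) * (#(bohrSet S a l) - 1)) := by ring
      _ ≤ _ := by gcongr
  · have h1 : #(bohrSet S a l) - 1 ≤ #(bohrSet S a (W ^ 2 : ℕ)) :=
      (Nat.sub_le _ _).trans (card_le_card (bohrSet_mono (by exact_mod_cast hlW)))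
    exact Nat.mul_le_mul (by omega) h1

theorem sum_add_one_mul_pow_le {q : ℝ} (h0 : 0 ≤ q) (h1 : q ≤ 16 / 17) (L : ℕ) :
    ∑ l ∈ range L, ((l : ℝ) + 1) * q ^ l ≤ 289 := by
  have key : ∑ l ∈ range L, ((l : ℝ) + 1) * (16 / 17 : ℝ) ^ l + (289 + 17 * L) * (16 / 17) ^ L
      = 289 := by
    induction L with
    | zero => simp
    | succ L ih =>
      rw [sum_range_succ]
      push_cast
      rw [pow_succ]
      linarith
  have h2 : ∑ l ∈ range L, ((l : ℝ) + 1) * q ^ l ≤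
      ∑ l ∈ range L, ((l : ℝ) + 1) * (16 / 17 : ℝ) ^ l := by gcongr
  have : (0 : ℝ) ≤ (289 + 17 * L) * (16 / 17) ^ L := by positivity
  linarith

/-- Halász's inequality: the exponential sum that bounds the concentration probability is
controlled by the size of one Bohr set, with a gain of `W` for the radius `W²`. The constant is
`578 = 2 * 289`, from `mul_card_bohrSet_le` and `sum_add_one_mul_pow_le`. -/
theorem sum_exp_phaseDeviation_le {p : ℕ} [Fact p.Prime] {ι : Type*} {S : Finset ι}
    {a : ι → ZMod p} (ha : ∀ j ∈ S, a j ≠ 0) {W : ℕ} (hW0 : 1 ≤ W) (hW : W ^ 2 < 2 * #S) :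
    ∑ r, Real.exp (-phaseDeviation S a r / 16) ≤
      1 + 578 * #(bohrSet S a (W ^ 2 : ℕ)) / W + p * Real.exp (-(W : ℝ) ^ 2 / 16) := by
  set g := phaseDeviation S a
  set N : ℝ := ((#(bohrSet S a (W ^ 2 : ℕ)) : ℕ) : ℝ)
  have hWpos : (0 : ℝ) < W := by exact_mod_cast hW0
  have hg0 : ∀ r, 0 ≤ g r := phaseDeviation_nonneg S a
  set q := Real.exp (-1 / 16)
  have hq : q ≤ 16 / 17 := by
    have h1 := Real.add_one_le_exp (1 / 16)
    have h2 : q * Real.exp (1 / 16) = 1 := by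
      rw [← Real.exp_add]; norm_num
    have : 0 < q := Real.exp_pos _
    nlinarith
  have hq0 : 0 ≤ q := (Real.exp_pos _).le
  set A : Finset (ZMod p) := {r | r ≠ 0 ∧ g r < W ^ 2}
  have hpt : ∀ r, Real.exp (-g r / 16) ≤ (if r = 0 then 1 else 0) +
      (if r ∈ A then Real.exp (-g r / 16) else 0) + Real.exp (-(W : ℝ) ^ 2 / 16) := by
    intro r
    have hpos := Real.exp_pos (-(W : ℝ) ^ 2 / 16)
    by_cases h0 : r = 0
    · have : g r = 0 := by rw [h0]; exact phaseDeviation_zero S a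
      rw [this, if_pos h0, if_neg (by simp [A, h0])]
      simpa using hpos.le
    · by_cases hr : g r < W ^ 2
      · simp [A, h0, hr]; exact hpos.le
      · simp only [h0, if_false, A, mem_filter, mem_univ, ne_eq, not_false_eq_true, hr,
          zero_add, and_false]
        apply Real.exp_le_exp.2; linarith
  have hmid : ∑ r ∈ A, Real.exp (-g r / 16) ≤ 578 * N / W := by
    have hmaps : ∀ r ∈ A, ⌊g r⌋₊ ∈ range (W ^ 2) := by
      intro r hr
      rw [mem_range, Nat.floor_lt (hg0 r)]
      exact_mod_cast (mem_filter.1 hr).2.2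
    rw [← sum_fiberwise_of_maps_to hmaps]
    have hlev : ∀ l ∈ range (W ^ 2), ∑ r ∈ A with ⌊g r⌋₊ = l, Real.exp (-g r / 16) ≤
        (2 * N / W) * (((l : ℝ) + 1) * q ^ l) := by
      intro l hl
      have hcard : #(filter (fun r => ⌊g r⌋₊ = l) A) ≤ #(bohrSet S a (l + 1 : ℕ)) - 1 := by
        rw [← card_erase_of_mem (zero_mem_bohrSet (S := S) (a := a) (Nat.cast_nonneg (l + 1)))]
        refine card_le_card fun r hr => ?_
        simp only [mem_filter, A, mem_univ, true_and] at hr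
        rw [mem_erase, mem_bohrSet]
        refine ⟨hr.1.1, ?_⟩
        have := Nat.lt_floor_add_one (g r)
        rw [hr.2] at this
        push_cast
        exact this.le
      have hb := mul_card_bohrSet_le ha hW (l := l + 1) (by omega) (mem_range.1 hl)
      have hb' : (W : ℝ) * (#(bohrSet S a (l + 1 : ℕ)) - 1 : ℕ) ≤ 2 * (l + 1) * N := by
        simp only [N]
        exact_mod_cast hb
      calc ∑ r ∈ A with ⌊g r⌋₊ = l, Real.exp (-g r / 16)
          ≤ ∑ r ∈ A with ⌊g r⌋₊ = l, q ^ l := by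
            refine sum_le_sum fun r hr => ?_
            rw [← Real.exp_nat_mul]
            apply Real.exp_le_exp.2
            have := Nat.floor_le (hg0 r)
            rw [(mem_filter.1 hr).2] at this
            linarith
        _ = #(filter (fun r => ⌊g r⌋₊ = l) A) * q ^ l := by rw [sum_const, nsmul_eq_mul]
        _ ≤ (#(bohrSet S a (l + 1 : ℕ)) - 1 : ℕ) * q ^ l := by gcongr
        _ ≤ (2 * (l + 1) * N / W) * q ^ l := by
            gcongr
            rw [le_div_iff₀ hWpos]; linarith
        _ = _ := by ring
    refine (sum_le_sum hlev).trans ?_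
    rw [← mul_sum]
    calc 2 * N / W * ∑ l ∈ range (W ^ 2), ((l : ℝ) + 1) * q ^ l ≤ 2 * N / W * 289 := by
          gcongr
          exact sum_add_one_mul_pow_le hq0 hq _
      _ = _ := by ring
  refine (sum_le_sum fun r _ => hpt r).trans ?_
  rw [sum_add_distrib, sum_add_distrib, sum_ite_eq' univ, sum_const, card_univ, ZMod.card,
    nsmul_eq_mul, sum_ite_mem, univ_inter]
  simp only [mem_univ, if_true]
  gcongr

end

/-! ### Signed additive relations -/

section

open Finset ZMod

/-- The sum `∑ₜ ± a_{iₜ}` described by a sequence of indices with signs. -/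
def signedSum {G ι : Type*} [AddCommGroup G] {m : ℕ} (a : ι → G) (σ : Fin m → ι × ℤˣ) : G :=
  ∑ t, ((σ t).2 : ℤ) • a (σ t).1

/-- All sequences of `m` signed indices taken from `S`. -/
def signedIndexSeqs {ι : Type*} (S : Finset ι) (m : ℕ) : Finset (Fin m → ι × ℤˣ) :=
  Fintype.piFinset fun _ => S ×ˢ univ

theorem mem_signedIndexSeqs {ι : Type*} {S : Finset ι} {m : ℕ} {σ : Fin m → ι × ℤˣ} :
    σ ∈ signedIndexSeqs S m ↔ ∀ t, (σ t).1 ∈ S := by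
  simp [signedIndexSeqs, Int.units_eq_one_or]

theorem card_signedIndexSeqs {ι : Type*} (S : Finset ι) (m : ℕ) :
    #(signedIndexSeqs S m) = (2 * #S) ^ m := by
  simp [signedIndexSeqs, mul_comm]

/-- The signed relations `∑ₜ ± a_{iₜ} = 0` of length `m` among the `a_i`, `i ∈ S`. -/
def signedRelations {G ι : Type*} [AddCommGroup G] [DecidableEq G] (S : Finset ι) (a : ι → G)
    (m : ℕ) : Finset (Fin m → ι × ℤˣ) :=
  {σ ∈ signedIndexSeqs S m | signedSum a σ = 0}

/-- Some index occurs exactly once in the sequence. -/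
def HasUniqueIndex {ι : Type*} {m : ℕ} (σ : Fin m → ι × ℤˣ) : Prop :=
  ∃ t, ∀ t', (σ t').1 = (σ t).1 → t' = t

open Classical in
/-- The signed relations in which some index occurs exactly once. The value of `a` at such an index
is determined by its other values. -/
noncomputable def uniqueRelations {G ι : Type*} [AddCommGroup G] [DecidableEq G] (S : Finset ι)
    (a : ι → G) (m : ℕ) : Finset (Fin m → ι × ℤˣ) :=
  {σ ∈ signedRelations S a m | HasUniqueIndex σ}

/-- The number of signed relations is the average of a power of
a cosine sum. -/
theorem sum_cos_pow_eq {p : ℕ} [Fact p.Prime] {ι : Type*} (S : Finset ι) (a : ι → ZMod p)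
    (m : ℕ) :
    ∑ r : ZMod p, (∑ j ∈ S, 2 * (stdAddChar (a j * r) : ℂ).re) ^ m =
      p * #(signedRelations S a m) := by
  have hu : (Finset.univ : Finset ℤˣ) = {1, -1} := by decide
  have h1 : ∀ r : ZMod p, (((∑ j ∈ S, 2 * (stdAddChar (a j * r) : ℂ).re) ^ m : ℝ) : ℂ) =
      ∑ σ ∈ signedIndexSeqs S m, stdAddChar (r * signedSum a σ) := by
    intro r
    have h2 : ((∑ j ∈ S, 2 * (stdAddChar (a j * r) : ℂ).re : ℝ) : ℂ) =
        ∑ x ∈ S ×ˢ (univ : Finset ℤˣ), stdAddChar (((x.2 : ℤ) • a x.1) * r) := by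
      rw [sum_product, Complex.ofReal_sum]
      refine sum_congr rfl fun j _ => ?_
      rw [hu, sum_insert (by decide), sum_singleton, ← stdAddChar_add_neg]
      simp
    rw [Complex.ofReal_pow, h2, signedIndexSeqs, ← Fin.prod_const, prod_univ_sum]
    refine sum_congr rfl fun σ _ => ?_
    rw [← AddChar.map_sum_prod, signedSum, mul_comm, sum_mul]
  have h3 : ((∑ r : ZMod p, (∑ j ∈ S, 2 * (stdAddChar (a j * r) : ℂ).re) ^ m : ℝ) : ℂ) =
      ((p * #(signedRelations S a m) : ℝ) : ℂ) := by
    rw [Complex.ofReal_sum]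
    simp_rw [h1]
    rw [sum_comm]
    simp_rw [AddChar.sum_mulShift _ (isPrimitive_stdAddChar p), ZMod.card]
    push_cast
    rw [← sum_filter, sum_const, nsmul_eq_mul, mul_comm]
    rfl
  exact_mod_cast h3

/-- A Bohr set of small radius is bounded by a moment of the cosine sum, which is nearly maximal
on it. -/
theorem card_bohrSet_mul_le {p : ℕ} [Fact p.Prime] {ι : Type*} {S : Finset ι} (a : ι → ZMod p)
    {W k : ℕ} (hS : 0 < #S) (hk : 2 * k * W ^ 2 ≤ #S) (hWS : W ^ 2 ≤ 2 * #S) :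
    (#(bohrSet S a (W ^ 2 : ℕ)) : ℝ) * (2 * #S) ^ (2 * k) ≤
      2 * p * #(signedRelations S a (2 * k)) := by
  have hW' : (W : ℝ) ^ 2 ≤ 2 * #S := by exact_mod_cast hWS
  have hs : (0 : ℝ) < #S := by exact_mod_cast hS
  have hk' : 2 * (k : ℝ) * W ^ 2 ≤ #S := by exact_mod_cast hk
  rw [mul_assoc, ← sum_cos_pow_eq]
  have hpt : ∀ r ∈ bohrSet S a (W ^ 2 : ℕ), (2 * (#S : ℝ)) ^ (2 * k) / 2 ≤
      (∑ j ∈ S, 2 * (stdAddChar (a j * r) : ℂ).re) ^ (2 * k) := by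
    intro r hr
    rw [mem_bohrSet, phaseDeviation_eq] at hr
    push_cast at hr
    have hb := one_add_mul_le_pow (a := -((W : ℝ) ^ 2 / (2 * #S))) (by
      have : (W : ℝ) ^ 2 / (2 * #S) ≤ 1 := by rw [div_le_one (by positivity)]; exact hW'
      linarith) (2 * k)
    have h1 : (1 : ℝ) / 2 ≤ 1 + ((2 * k : ℕ) : ℝ) * -((W : ℝ) ^ 2 / (2 * #S)) := by
      have : ((2 * k : ℕ) : ℝ) * ((W : ℝ) ^ 2 / (2 * #S)) ≤ 1 / 2 := by
        push_cast
        rw [mul_div_assoc', div_le_iff₀ (by positivity)]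
        linarith
      linarith
    calc (2 * (#S : ℝ)) ^ (2 * k) / 2 = (2 * (#S : ℝ)) ^ (2 * k) * (1 / 2) := by ring
      _ ≤ (2 * (#S : ℝ)) ^ (2 * k) * (1 + -((W : ℝ) ^ 2 / (2 * #S))) ^ (2 * k) := by
          gcongr; exact h1.trans hb
      _ = (2 * #S - W ^ 2 : ℝ) ^ (2 * k) := by
          rw [← mul_pow]; congr 1; field_simp; ring
      _ ≤ _ := by
          apply pow_le_pow_left₀ (by linarith)
          linarith
  have hsum : (#(bohrSet S a (W ^ 2 : ℕ)) : ℝ) * ((2 * (#S : ℝ)) ^ (2 * k) / 2) ≤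
      ∑ r, (∑ j ∈ S, 2 * (stdAddChar (a j * r) : ℂ).re) ^ (2 * k) := by
    rw [← nsmul_eq_mul, ← sum_const]
    refine (sum_le_sum hpt).trans (sum_le_sum_of_subset_of_nonneg (subset_univ _) ?_)
    intro r _ _
    exact (even_two_mul k).pow_nonneg _
  linarith

/-- Halász's inequality with signed relations: `W` is the gain over the trivial bound. -/
theorem sum_exp_le_relations {p : ℕ} [Fact p.Prime] {ι : Type*} {S : Finset ι}
    {a : ι → ZMod p} (ha : ∀ j ∈ S, a j ≠ 0) {W k : ℕ} (hW0 : 1 ≤ W) (hk0 : 1 ≤ k)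
    (hk : 2 * k * W ^ 2 ≤ #S) :
    (p : ℝ)⁻¹ * ∑ r, Real.exp (-phaseDeviation S a r / 16) ≤
      1 / p + 1156 * #(signedRelations S a (2 * k)) / ((2 * #S) ^ (2 * k) * W) +
        Real.exp (-(W : ℝ) ^ 2 / 16) := by
  have hW1 : 1 ≤ W ^ 2 := Nat.one_le_pow _ _ hW0
  have hWS : W ^ 2 < 2 * #S := by nlinarith
  have hS : 0 < #S := by omega
  have hs : (0 : ℝ) < #S := by exact_mod_cast hS
  have hw : (0 : ℝ) < W := by exact_mod_cast hW0
  have hp : (0 : ℝ) < p := by exact_mod_cast (Fact.out : p.Prime).pos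
  have h1 := sum_exp_phaseDeviation_le ha hW0 hWS
  have h2 := card_bohrSet_mul_le a hS hk hWS.le
  rw [← le_div_iff₀ (by positivity)] at h2
  rw [inv_mul_le_iff₀ hp]
  refine h1.trans ?_
  calc _ ≤ 1 + 578 * (2 * p * #(signedRelations S a (2 * k)) / (2 * #S) ^ (2 * k)) / W +
        p * Real.exp (-(W : ℝ) ^ 2 / 16) := by gcongr
    _ = _ := by field_simp; ring

open Classical in
/-- Sequences without an index of multiplicity one use at most half as many indices as terms. -/
theorem card_not_hasUniqueIndex_le {ι : Type*} (S : Finset ι) {k : ℕ} (hk : 1 ≤ k) :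
    #{σ ∈ signedIndexSeqs S (2 * k) | ¬ HasUniqueIndex σ} ≤
      (#S) ^ k * k ^ (2 * k) * 2 ^ (2 * k) := by
  set T := Fintype.piFinset (fun _ : Fin k => S) ×ˢ
    ((univ : Finset (Fin (2 * k) → Fin k)) ×ˢ (univ : Finset (Fin (2 * k) → ℤˣ)))
  have hT : #T = (#S) ^ k * k ^ (2 * k) * 2 ^ (2 * k) := by
    simp [T, card_product, mul_assoc]
  rw [← hT]
  refine card_le_card_of_surjOn (fun x t => (x.1 (x.2.1 t), x.2.2 t)) fun σ hσ => ?_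
  obtain ⟨hσS, hσu⟩ := mem_filter.1 (mem_coe.1 hσ)
  rw [mem_signedIndexSeqs] at hσS
  set I := univ.image fun t => (σ t).1
  have hI : #I ≤ k := by
    have hfib : ∀ i ∈ I, 2 ≤ #{t | (σ t).1 = i} := by
      intro i hi
      obtain ⟨t, -, rfl⟩ := mem_image.1 hi
      by_contra! hlt
      refine hσu ⟨t, fun t' ht' => ?_⟩
      have h1 := card_le_one.1 (Nat.lt_succ_iff.1 hlt)
      exact h1 t' (by simp [ht']) t (by simp)
    have h1 := card_eq_sum_card_image (fun t => (σ t).1) univ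
    have h2 := card_nsmul_le_sum I _ 2 hfib
    rw [card_univ, Fintype.card_fin] at h1
    rw [smul_eq_mul] at h2
    have h3 : #I * 2 ≤ 2 * k := h2.trans_eq h1.symm
    omega
  have hmem : ∀ t, (σ t).1 ∈ I := fun t => mem_image_of_mem _ (mem_univ t)
  obtain ⟨emb⟩ := Function.Embedding.nonempty_of_card_le (α := I) (β := Fin k) (by simpa using hI)
  have : Nonempty I := ⟨⟨_, hmem ⟨0, by omega⟩⟩⟩
  refine ⟨(fun x => (Function.invFun emb x : I), (fun t => emb ⟨_, hmem t⟩, fun t => (σ t).2)),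
    ?_, ?_⟩
  · simp only [T, coe_product, Set.mem_prod, mem_coe, Fintype.mem_piFinset, mem_univ, and_true]
    intro x
    obtain ⟨t, -, ht⟩ := mem_image.1 (Function.invFun emb x : I).2
    rw [← ht]; exact hσS t
  · funext t
    simp [Function.leftInverse_invFun emb.injective _]

theorem card_signedRelations_le {G ι : Type*} [AddCommGroup G] [DecidableEq G] (S : Finset ι)
    (a : ι → G) {k : ℕ} (hk : 1 ≤ k) :
    #(signedRelations S a (2 * k)) ≤ #(uniqueRelations S a (2 * k)) +
      (#S) ^ k * k ^ (2 * k) * 2 ^ (2 * k) := by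
  classical
  rw [← card_filter_add_card_filter_not (s := signedRelations S a (2 * k)) HasUniqueIndex]
  refine Nat.add_le_add (le_of_eq ?_) (le_trans (card_le_card ?_) (card_not_hasUniqueIndex_le S hk))
  · unfold uniqueRelations; congr
  · exact filter_subset_filter _ (filter_subset _ _)

end

/-! ### Counting vectors with many signed relations -/

section

open Finset

theorem uniqueRelations_congr {G ι : Type*} [AddCommGroup G] [DecidableEq G] {S : Finset ι}
    {a a' : ι → G} (h : ∀ i ∈ S, a i = a' i) (m : ℕ) :
    uniqueRelations S a m = uniqueRelations S a' m := by
  have : signedRelations S a m = signedRelations S a' m := by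
    refine filter_congr fun σ hσ => ?_
    rw [mem_signedIndexSeqs] at hσ
    unfold signedSum
    rw [sum_congr rfl fun t _ => by rw [h _ (hσ t)]]
  unfold uniqueRelations
  rw [this]

theorem card_uniqueRelations_le {G ι : Type*} [AddCommGroup G] [DecidableEq G] (S : Finset ι)
    (a : ι → G) (m : ℕ) : #(uniqueRelations S a m) ≤ (2 * #S) ^ m := by
  rw [← card_signedIndexSeqs]
  refine card_le_card fun σ hσ => ?_
  simp only [uniqueRelations, signedRelations, mem_filter] at hσ
  exact hσ.1.1

/-- The least number of signed relations with an index of multiplicity one, over all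
`s`-element subsets of `D`. -/
noncomputable def minRelations {G ι : Type*} [AddCommGroup G] [DecidableEq G] (a : ι → G)
    (s m : ℕ) (D : Finset ι) : ℕ :=
  sInf ((fun S => #(uniqueRelations S a m)) '' {S | S ⊆ D ∧ #S = s})

theorem minRelations_le {G ι : Type*} [AddCommGroup G] [DecidableEq G] (a : ι → G)
    {s : ℕ} (m : ℕ) {D S : Finset ι} (hS : S ⊆ D) (hs : #S = s) :
    minRelations a s m D ≤ #(uniqueRelations S a m) :=
  Nat.sInf_le ⟨S, ⟨hS, hs⟩, rfl⟩

theorem exists_minRelations_eq {G ι : Type*} [AddCommGroup G] [DecidableEq G] (a : ι → G)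
    {s : ℕ} (m : ℕ) {D : Finset ι} (hs : s ≤ #D) :
    ∃ S ⊆ D, #S = s ∧ #(uniqueRelations S a m) = minRelations a s m D := by
  obtain ⟨S₀, h0, h1⟩ := exists_subset_card_eq hs
  obtain ⟨S, ⟨hS, hs⟩, h⟩ := Nat.sInf_mem
    (s := (fun S => #(uniqueRelations S a m)) '' {S | S ⊆ D ∧ #S = s}) ⟨_, S₀, ⟨h0, h1⟩, rfl⟩
  exact ⟨S, hS, hs, h⟩

/-- The vectors supported in `D`. -/
def supportedIn {G : Type*} (ι : Type*) [Zero G] [DecidableEq G] [Fintype G] [Fintype ι]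
    [DecidableEq ι] (D : Finset ι) : Finset (ι → G) :=
  {a | ∀ i ∉ D, a i = 0}

theorem mem_supportedIn {G ι : Type*} [Zero G] [DecidableEq G] [Fintype G] [Fintype ι]
    [DecidableEq ι] {D : Finset ι} {a : ι → G} : a ∈ supportedIn ι D ↔ ∀ i ∉ D, a i = 0 := by
  simp [supportedIn]

theorem card_supportedIn {G ι : Type*} [Zero G] [DecidableEq G] [Fintype G] [Fintype ι]
    [DecidableEq ι] (D : Finset ι) :
    #(supportedIn ι D : Finset (ι → G)) = Fintype.card G ^ #D := by
  have : (supportedIn ι D : Finset (ι → G)) =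
      Fintype.piFinset fun i => if i ∈ D then univ else {0} := by
    ext a
    simp only [mem_supportedIn, Fintype.mem_piFinset]
    refine forall_congr' fun i => ?_
    by_cases h : i ∈ D <;> simp [h]
  rw [this, Fintype.card_piFinset, ← prod_subset (subset_univ D)]
  · rw [prod_congr rfl fun i hi => by rw [if_pos hi, card_univ], prod_const]
  · intro i _ hi
    simp [hi]

theorem eq_of_signedSum_eq_zero {G ι : Type*} [AddCommGroup G] {m : ℕ} {σ : Fin m → ι × ℤˣ}
    {t : Fin m} (ht : ∀ t', (σ t').1 = (σ t).1 → t' = t) {a a' : ι → G}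
    (ha : signedSum a σ = 0) (ha' : signedSum a' σ = 0)
    (h : ∀ i ≠ (σ t).1, a i = a' i) : a = a' := by
  have h1 : ∑ u, ((σ u).2 : ℤ) • (a (σ u).1 - a' (σ u).1) = 0 := by
    simp_rw [smul_sub, sum_sub_distrib]
    unfold signedSum at ha ha'
    rw [ha, ha', sub_zero]
  rw [sum_eq_single t (fun u _ hu => by
    rw [h _ (fun he => hu (ht u he)), sub_self, smul_zero]) (by simp)] at h1
  funext i
  by_cases hi : i = (σ t).1
  · subst hi
    rcases Int.units_eq_one_or (σ t).2 with he | he <;> rw [he] at h1 <;>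
      simp only [Units.val_one, Units.val_neg, one_smul, neg_smul, neg_eq_zero] at h1 <;>
      exact sub_eq_zero.1 h1
  · exact h i hi

/-- Vectors all of whose `s`-element subvectors satisfy many signed relations are rare. Each such
relation with an index of multiplicity one allows one to delete that index and to recover the
deleted entry; iterating down to `s` entries encodes the vector in few ways. -/
theorem sum_minRelations_pow_le {G ι : Type*} [AddCommGroup G] [DecidableEq G] [Fintype G]
    [Fintype ι] [DecidableEq ι] (s m e : ℕ) :
    ∀ D : Finset ι, #D = s + e →
      ∑ a ∈ (supportedIn ι D : Finset (ι → G)), minRelations a s m D ^ e ≤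
        ((2 * s) ^ m) ^ e * Fintype.card G ^ s := by
  classical
  induction e with
  | zero =>
    intro D hD
    simp only [pow_zero, sum_const, smul_eq_mul, mul_one, one_mul]
    rw [card_supportedIn, hD, add_zero]
  | succ e ih =>
    intro D hD
    obtain ⟨S, hSD, hS⟩ := exists_subset_card_eq (show s ≤ #D by omega)
    set U := {σ ∈ signedIndexSeqs S m | HasUniqueIndex σ}
    have hcard : ∀ a : ι → G, #(uniqueRelations S a m) = #{σ ∈ U | signedSum a σ = 0} := by
      intro a
      congr 1
      ext σ
      simp only [uniqueRelations, signedRelations, U, mem_filter]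
      tauto
    calc ∑ a ∈ (supportedIn ι D : Finset (ι → G)), minRelations a s m D ^ (e + 1)
        ≤ ∑ a ∈ (supportedIn ι D : Finset (ι → G)),
            ∑ σ ∈ U, if signedSum a σ = 0 then minRelations a s m D ^ e else 0 := by
          refine sum_le_sum fun a _ => ?_
          rw [← sum_filter, sum_const, smul_eq_mul, ← hcard, pow_succ, mul_comm]
          exact Nat.mul_le_mul_right _ (minRelations_le a m hSD hS)
      _ = ∑ σ ∈ U, ∑ a ∈ supportedIn ι D with signedSum a σ = 0,
            minRelations (G := G) a s m D ^ e := by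
          rw [sum_comm]
          exact sum_congr rfl fun σ _ => by rw [sum_filter]
      _ ≤ ∑ σ ∈ U, ((2 * s) ^ m) ^ e * Fintype.card G ^ s := by
          refine sum_le_sum fun σ hσ => ?_
          obtain ⟨hσS, t, ht⟩ := mem_filter.1 hσ
          rw [mem_signedIndexSeqs] at hσS
          have hiD : (σ t).1 ∈ D := hSD (hσS t)
          refine le_trans ?_ (ih (D.erase (σ t).1) (by rw [card_erase_of_mem hiD]; omega))
          have hinj : Set.InjOn (fun a : ι → G => Function.update a (σ t).1 0)
              ({a ∈ supportedIn ι D | signedSum a σ = 0} : Finset (ι → G)) := by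
            intro a ha a' ha' haa
            refine eq_of_signedSum_eq_zero ht (mem_filter.1 (mem_coe.1 ha)).2
              (mem_filter.1 (mem_coe.1 ha')).2 fun i hi => ?_
            have := congrFun haa i
            simpa [hi] using this
          calc ∑ a ∈ supportedIn ι D with signedSum a σ = 0, minRelations (G := G) a s m D ^ e
              ≤ ∑ a ∈ supportedIn ι D with signedSum a σ = 0,
                  minRelations (G := G) (Function.update a (σ t).1 0) s m
                    (D.erase (σ t).1) ^ e := by
                refine sum_le_sum fun a _ => Nat.pow_le_pow_left ?_ e
                obtain ⟨S', hS', hs', he⟩ := exists_minRelations_eq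
                  (Function.update a (σ t).1 0) m
                  (show s ≤ #(D.erase (σ t).1) by rw [card_erase_of_mem hiD]; omega)
                rw [← he, ← uniqueRelations_congr (a := a)]
                · exact minRelations_le a m (hS'.trans (erase_subset _ _)) hs'
                · intro i hi
                  rw [Function.update_of_ne (ne_of_mem_erase (hS' hi))]
            _ = ∑ b ∈ ({a ∈ supportedIn ι D | signedSum a σ = 0} : Finset (ι → G)).image
                  (fun a => Function.update a (σ t).1 0),
                  minRelations b s m (D.erase (σ t).1) ^ e := by
                rw [sum_image hinj]
            _ ≤ _ := by
                refine sum_le_sum_of_subset fun b hb => ?_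
                obtain ⟨a, ha, rfl⟩ := mem_image.1 hb
                have ha := (mem_filter.1 ha).1
                rw [mem_supportedIn] at ha ⊢
                intro i hi
                by_cases h : i = (σ t).1
                · simp [h]
                · rw [Function.update_of_ne h]
                  exact ha i fun hD => hi (mem_erase.2 ⟨h, hD⟩)
      _ ≤ (2 * s) ^ m * (((2 * s) ^ m) ^ e * Fintype.card G ^ s) := by
          rw [sum_const, smul_eq_mul]
          refine Nat.mul_le_mul_right _ ?_
          rw [← hS, ← card_signedIndexSeqs]
          exact card_le_card (filter_subset _ _)
      _ = _ := by ring

end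

/-! ### Random symmetric sign matrices -/

section

open Finset

theorem finite_symSignMatrices (n : ℕ) : (symSignMatrices n).Finite :=
  (Set.Finite.pi' fun _ => Set.Finite.pi' fun _ => Set.toFinite ({1, -1} : Set ℤ)).subset
    fun _ hM i j => hM.2 i j

/-- The finite set underlying `symSignMatrices`. -/
noncomputable def symSignFinset (n : ℕ) : Finset (Matrix (Fin n) (Fin n) ℤ) :=
  (finite_symSignMatrices n).toFinset

theorem mem_symSignFinset {n : ℕ} {M : Matrix (Fin n) (Fin n) ℤ} :
    M ∈ symSignFinset n ↔ M.IsSymm ∧ ∀ i j, M i j = 1 ∨ M i j = -1 := by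
  simp [symSignFinset, symSignMatrices]

theorem card_symSignFinset_pos (n : ℕ) : 0 < #(symSignFinset n) :=
  card_pos.2 ⟨fun _ _ => 1, mem_symSignFinset.2 ⟨rfl, fun _ _ => Or.inl rfl⟩⟩

open Classical in
theorem probSymSign_eq (n : ℕ) (E : Set (Matrix (Fin n) (Fin n) ℤ)) :
    probSymSign n E = (#{M ∈ symSignFinset n | M ∈ E} : ℝ) / #(symSignFinset n) := by
  have h : symSignMatrices n = ↑(symSignFinset n) := by simp [symSignFinset]
  have h2 : symSignMatrices n ∩ E = ↑({M ∈ symSignFinset n | M ∈ E} : Finset _) := by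
    rw [coe_filter, h]; rfl
  rw [probSymSign, h2, h, Set.ncard_coe_finset, Set.ncard_coe_finset]

/-- Multiply the entries `M i j` and `M j i` with `i ∉ S`, `j ∈ S` by the sign `y i j`. -/
def twist {n : ℕ} (S : Finset (Fin n)) (y : Fin n → Fin n → ℤˣ) (M : Matrix (Fin n) (Fin n) ℤ) :
    Matrix (Fin n) (Fin n) ℤ :=
  fun i j => M i j * (if i ∉ S ∧ j ∈ S then y i j else if j ∉ S ∧ i ∈ S then y j i else 1 : ℤˣ)

theorem twist_mem {n : ℕ} {S : Finset (Fin n)} {y : Fin n → Fin n → ℤˣ}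
    {M : Matrix (Fin n) (Fin n) ℤ} (hM : M ∈ symSignFinset n) : twist S y M ∈ symSignFinset n := by
  rw [mem_symSignFinset] at *
  refine ⟨?_, fun i j => ?_⟩
  · ext i j
    have := hM.1.apply i j
    simp only [Matrix.transpose_apply, twist, this]
    by_cases hi : i ∈ S <;> by_cases hj : j ∈ S <;> simp [hi, hj]
  · unfold twist
    generalize (if i ∉ S ∧ j ∈ S then y i j else if j ∉ S ∧ i ∈ S then y j i else 1 : ℤˣ) = u
    rcases Int.units_eq_one_or u with h | h <;> rcases hM.2 i j with h' | h' <;> simp [h, h']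

theorem twist_twist {n : ℕ} (S : Finset (Fin n)) (y : Fin n → Fin n → ℤˣ)
    (M : Matrix (Fin n) (Fin n) ℤ) : twist S y (twist S y M) = M := by
  ext i j
  unfold twist
  generalize (if i ∉ S ∧ j ∈ S then y i j else if j ∉ S ∧ i ∈ S then y j i else 1 : ℤˣ) = u
  rw [mul_assoc, ← Units.val_mul, Int.units_mul_self, Units.val_one, mul_one]

/-- The rows outside `S` are independent given the entries outside `Sᶜ × S` and `S × Sᶜ`, so
their probability of being orthogonal to `a` is at most a power of the concentration probability
`ρ` of the part of `a` in `S`. -/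
theorem card_orth_rows_le {R : Type*} [CommRing R] [DecidableEq R] {n : ℕ} (a : Fin n → R)
    (S I : Finset (Fin n)) (hIS : Disjoint I S) {ρ : ℝ}
    (hρ : ∀ c : R, (#{y : Fin n → ℤˣ | ∑ j ∈ S, a j * ((y j : ℤ) : R) = c} : ℝ) ≤ ρ * 2 ^ n) :
    (#{M ∈ symSignFinset n | ∀ i ∈ I, ∑ j, a j * (M i j : R) = 0} : ℝ) ≤
      #(symSignFinset n) * ρ ^ #I := by
  classical
  set cond : Matrix (Fin n) (Fin n) ℤ → Prop := fun M => ∀ i ∈ I, ∑ j, a j * (M i j : R) = 0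
  have hρ0 : 0 ≤ ρ := by
    have h := (Nat.cast_nonneg _).trans (hρ 0)
    exact nonneg_of_mul_nonneg_left h (by positivity)
  have hY : Fintype.card (Fin n → Fin n → ℤˣ) = (2 ^ n) ^ n := by simp
  -- averaging over all twists
  have havg : #{M ∈ symSignFinset n | cond M} * (2 ^ n) ^ n =
      ∑ M ∈ symSignFinset n, #{y : Fin n → Fin n → ℤˣ | cond (twist S y M)} := by
    have h1 : ∀ y : Fin n → Fin n → ℤˣ, #{M ∈ symSignFinset n | cond M} =
        #{M ∈ symSignFinset n | cond (twist S y M)} := by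
      intro y
      refine card_nbij' (twist S y) (twist S y) ?_ ?_ (fun M _ => twist_twist S y M)
        (fun M _ => twist_twist S y M)
      · intro M hM
        rw [mem_coe, mem_filter] at hM ⊢
        exact ⟨twist_mem hM.1, by rw [twist_twist]; exact hM.2⟩
      · intro M hM
        rw [mem_coe, mem_filter] at hM ⊢
        exact ⟨twist_mem hM.1, hM.2⟩
    calc #{M ∈ symSignFinset n | cond M} * (2 ^ n) ^ n
        = ∑ y : Fin n → Fin n → ℤˣ, #{M ∈ symSignFinset n | cond (twist S y M)} := by
          rw [← sum_congr rfl fun y _ => h1 y, sum_const, card_univ, hY, smul_eq_mul, mul_comm]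
      _ = _ := by
          simp_rw [card_filter]
          rw [sum_comm]
  have hfix : ∀ M ∈ symSignFinset n,
      (#{y : Fin n → Fin n → ℤˣ | cond (twist S y M)} : ℝ) ≤ ρ ^ #I * (2 ^ n) ^ n := by
    intro M hM
    rw [mem_symSignFinset] at hM
    choose u hu using fun i j => show ∃ u : ℤˣ, (u : ℤ) = M i j from
      (hM.2 i j).elim (fun h => ⟨1, by simp [h]⟩) fun h => ⟨-1, by simp [h]⟩
    set P : Fin n → Finset (Fin n → ℤˣ) := fun i =>
      if i ∈ I then
        univ.filter fun y => ∑ j ∈ S, a j * ((u i j * y j : ℤˣ) : ℤ) = -∑ j ∈ Sᶜ, a j * (M i j : R)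
      else univ
    have hsub : ({y | cond (twist S y M)} : Finset (Fin n → Fin n → ℤˣ)) ⊆
        Fintype.piFinset P := by
      intro y hy
      rw [Fintype.mem_piFinset]
      intro i
      by_cases hi : i ∈ I
      · simp only [P, if_pos hi, mem_filter, mem_univ, true_and]
        have h1 := (mem_filter.1 hy).2 i hi
        have hiS : i ∉ S := disjoint_left.1 hIS hi
        rw [← sum_add_sum_compl S] at h1
        rw [eq_neg_iff_add_eq_zero, ← h1]
        congr 1
        · refine sum_congr rfl fun j hj => ?_
          simp [twist, hiS, hj, hu]
        · refine sum_congr rfl fun j hj => ?_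
          simp [twist, hiS, mem_compl.1 hj]
      · simp [P, hi]
    have hPi : ∀ i, (#(P i) : ℝ) ≤ (if i ∈ I then ρ else 1) * 2 ^ n := by
      intro i
      by_cases hi : i ∈ I
      · simp only [P, if_pos hi]
        refine le_trans ?_ (hρ (-∑ j ∈ Sᶜ, a j * (M i j : R)))
        rw [Nat.cast_le]
        refine card_le_card_of_injOn (fun y => u i * y) (fun y hy => ?_)
          (mul_right_injective (u i)).injOn
        simpa using hy
      · simp [P, hi]
    calc (#{y : Fin n → Fin n → ℤˣ | cond (twist S y M)} : ℝ) ≤ #(Fintype.piFinset P) := by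
          exact_mod_cast card_le_card hsub
      _ = ∏ i, (#(P i) : ℝ) := by rw [Fintype.card_piFinset]; push_cast; rfl
      _ ≤ ∏ i, (if i ∈ I then ρ else 1) * 2 ^ n :=
          prod_le_prod (fun _ _ => Nat.cast_nonneg _) fun i _ => hPi i
      _ = _ := by
          rw [prod_mul_distrib, prod_const, card_univ, Fintype.card_fin, prod_ite_mem, univ_inter,
            prod_const]
  have hfin : (#{M ∈ symSignFinset n | cond M} : ℝ) * (2 ^ n) ^ n ≤
      (#(symSignFinset n) * ρ ^ #I) * (2 ^ n) ^ n := by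
    have h := sum_le_sum hfix
    rw [sum_const, nsmul_eq_mul] at h
    calc (#{M ∈ symSignFinset n | cond M} : ℝ) * (2 ^ n) ^ n =
        ((∑ M ∈ symSignFinset n, #{y : Fin n → Fin n → ℤˣ | cond (twist S y M)} : ℕ) : ℝ) := by
          rw [← havg]; push_cast; rfl
      _ ≤ _ := by push_cast; linarith
  exact le_of_mul_le_mul_right hfin (by positivity)

/-- A single non-zero coordinate of `a` already gives concentration probability at most `1/2`. -/
theorem card_sign_singleton_le {p : ℕ} [Fact p.Prime] (hp2 : p ≠ 2) {n : ℕ} {a : Fin n → ZMod p}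
    {j₀ : Fin n} (h : a j₀ ≠ 0) (c : ZMod p) :
    (#{y : Fin n → ℤˣ | ∑ j ∈ {j₀}, a j * ((y j : ℤ) : ZMod p) = c} : ℝ) ≤ 1 / 2 * 2 ^ n := by
  classical
  have h2 : (2 : ZMod p) ≠ 0 := by
    intro h
    have : ((2 : ℕ) : ZMod p) = 0 := by exact_mod_cast h
    rw [ZMod.natCast_eq_zero_iff] at this
    exact hp2 ((Nat.prime_dvd_prime_iff_eq Fact.out Nat.prime_two).1 this)
  set A := ({y : Fin n → ℤˣ | ∑ j ∈ {j₀}, a j * ((y j : ℤ) : ZMod p) = c} : Finset _)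
  -- negation of the coordinate `j₀` leads out of the set
  set f : (Fin n → ℤˣ) → (Fin n → ℤˣ) := fun y => Function.update y j₀ (-y j₀)
  have hf : Function.Injective f := by
    intro y y' hy
    funext j
    have := congrFun hy j
    by_cases hj : j = j₀
    · subst hj; simpa [f] using this
    · simpa [f, hj] using this
  have hd : Disjoint A (A.image f) := by
    rw [disjoint_left]
    intro y hy hy'
    obtain ⟨x, hx, rfl⟩ := mem_image.1 hy'
    simp only [A, mem_filter, mem_univ, true_and, sum_singleton, f, Function.update_self,
      Units.val_neg, Int.cast_neg, mul_neg] at hx hy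
    have h3 : 2 * (a j₀ * ((x j₀ : ℤ) : ZMod p)) = 0 := by linear_combination hx - hy
    rcases Int.units_eq_one_or (x j₀) with he | he <;> simp [he, h2, h] at h3
  have h4 := card_le_univ (A ∪ A.image f)
  rw [card_union_of_disjoint hd, card_image_of_injective _ hf] at h4
  simp only [Fintype.card_pi, Fintype.card_units_int, prod_const, card_univ, Fintype.card_fin] at h4
  have h5 : (#A : ℝ) + #A ≤ 2 ^ n := by exact_mod_cast h4
  linarith

end

/-! ### From integer vectors to vectors modulo `p`, and the union bound -/

section

open Finset ZMod

/-- The Fourier-analytic bound for the concentration probability of the part of `b` in `S`. -/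
noncomputable def fourierBound {p : ℕ} [NeZero p] {ι : Type*} (S : Finset ι) (b : ι → ZMod p) : ℝ :=
  (p : ℝ)⁻¹ * ∑ r, Real.exp (-phaseDeviation S b r / 16)

/-- The rows of `M` that are not orthogonal to `b` modulo `p`. -/
def nonOrthRows {p n : ℕ} (M : Matrix (Fin n) (Fin n) ℤ) (b : Fin n → ZMod p) : Finset (Fin n) :=
  {i | ¬ ∑ j, b j * (M i j : ZMod p) = 0}

theorem lazySignWeight_nonneg {μ : ℝ} (h0 : 0 ≤ μ) (h1 : μ ≤ 1 / 2) (t : SignType) :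
    0 ≤ lazySignWeight μ t := by
  unfold lazySignWeight; split_ifs <;> linarith

/-- An integer vector violating the event, divided by the gcd of its entries and reduced
modulo `p`, is non-zero, keeps its orthogonal rows, and has a large concentration probability. -/
theorem exists_zmod_vector {p n : ℕ} [Fact p.Prime] (hp2 : p ≠ 2) {a : Fin n → ℤ} (ha : a ≠ 0)
    {μ α : ℝ} (h0 : 0 ≤ μ) (h1 : μ ≤ 1 / 2) (hα : 0 ≤ α) (h : α < atomProb μ a) :
    ∃ b : Fin n → ZMod p, b ≠ 0 ∧ (∀ S, α < fourierBound S b) ∧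
      ∀ M : Matrix (Fin n) (Fin n) ℤ, #(nonOrthRows M b) + numOrthRows M a ≤ n := by
  obtain ⟨i₀, hi₀⟩ := Function.ne_iff.1 ha
  obtain ⟨g, hg, hg1⟩ := extract_gcd (s := univ) a ⟨i₀, mem_univ _⟩
  set G := univ.gcd a
  have hag : ∀ i, a i = G * g i := fun i => hg i (mem_univ i)
  have hG : G ≠ 0 := by
    intro hG
    apply hi₀
    rw [hag, hG, zero_mul]; rfl
  refine ⟨fun i => (g i : ZMod p), ?_, fun S => ?_, fun M => ?_⟩
  · intro hb
    have hdvd : (p : ℤ) ∣ univ.gcd g := dvd_gcd fun i _ =>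
      (ZMod.intCast_zmod_eq_zero_iff_dvd _ _).1 (congrFun hb i)
    rw [hg1] at hdvd
    exact (Fact.out : p.Prime).one_lt.ne' (by exact_mod_cast Int.eq_one_of_dvd_one (by positivity) hdvd)
  · obtain ⟨c, hc⟩ := exists_lt_of_lt_ciSup h
    refine hc.trans_le ?_
    rcases (filter (fun x : Fin n → SignType => ∑ i, a i * (x i : ℤ) = c) univ).eq_empty_or_nonempty
      with he | ⟨x₀, hx₀⟩
    · rw [probLinearFormEq, he, sum_empty] at hc
      linarith
    · refine le_trans ?_ (probLinearFormEq_le_exp hp2 h0 h1 _ S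
        ((∑ i, g i * (x₀ i : ℤ) : ℤ) : ZMod p))
      refine sum_le_sum_of_subset_of_nonneg (fun x hx => ?_) fun x _ _ =>
        prod_nonneg fun i _ => lazySignWeight_nonneg h0 h1 _
      rw [mem_filter] at *
      refine ⟨mem_univ _, ?_⟩
      have h2 : ∑ i, g i * (x i : ℤ) = ∑ i, g i * (x₀ i : ℤ) := by
        have h3 := hx.2.trans hx₀.2.symm
        simp_rw [hag, mul_assoc, ← mul_sum] at h3
        exact mul_left_cancel₀ hG h3
      rw [← h2]
      push_cast
      refine sum_congr rfl fun i _ => ?_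
      cases x i <;> simp
  · have hsub : univ.filter (fun i => M i ⬝ᵥ a = 0) ⊆ (nonOrthRows M fun i => (g i : ZMod p))ᶜ := by
      intro i hi
      rw [mem_compl, nonOrthRows, mem_filter, not_and, not_not]
      intro _
      have h2 : G * ∑ j, g j * M i j = 0 := by
        rw [← (mem_filter.1 hi).2, dotProduct, mul_sum]
        refine sum_congr rfl fun j _ => ?_
        rw [hag]; ring
      have h3 := (mul_eq_zero.1 h2).resolve_left hG
      have := congrArg (Int.cast : ℤ → ZMod p) h3
      push_cast at this
      exact this
    have h2 := card_le_card hsub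
    rw [card_compl, Fintype.card_fin] at h2
    have h3 := card_le_univ (nonOrthRows M fun i => (g i : ZMod p))
    rw [Fintype.card_fin] at h3
    unfold numOrthRows
    omega

/-- Union bound over the possible sets of `h` exceptional rows. -/
theorem card_few_nonOrthRows_le {p n : ℕ} [Fact p.Prime] (b : Fin n → ZMod p)
    (S : Finset (Fin n)) {h : ℕ} (hn : h ≤ n) {ρ : ℝ} (hρ0 : 0 ≤ ρ) (hρ1 : ρ ≤ 1)
    (hρ : ∀ c : ZMod p,
      (#{y : Fin n → ℤˣ | ∑ j ∈ S, b j * ((y j : ℤ) : ZMod p) = c} : ℝ) ≤ ρ * 2 ^ n) :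
    (#{M ∈ symSignFinset n | #(nonOrthRows M b) ≤ h} : ℝ) ≤
      n.choose h * (#(symSignFinset n) * ρ ^ (n - h - #S)) := by
  have hsub : {M ∈ symSignFinset n | #(nonOrthRows M b) ≤ h} ⊆
      (powersetCard h univ).biUnion fun J =>
        {M ∈ symSignFinset n | ∀ i ∈ (J ∪ S)ᶜ, ∑ j, b j * (M i j : ZMod p) = 0} := by
    intro M hM
    obtain ⟨hM, hMh⟩ := mem_filter.1 hM
    obtain ⟨J, hJ, hJc⟩ := exists_superset_card_eq hMh (by simpa using hn)
    rw [mem_biUnion]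
    refine ⟨J, mem_powersetCard.2 ⟨subset_univ _, hJc⟩, mem_filter.2 ⟨hM, fun i hi => ?_⟩⟩
    by_contra hne
    rw [mem_compl, mem_union, not_or] at hi
    exact hi.1 (hJ (mem_filter.2 ⟨mem_univ _, hne⟩))
  calc (#{M ∈ symSignFinset n | #(nonOrthRows M b) ≤ h} : ℝ)
      ≤ ∑ J ∈ powersetCard h (univ : Finset (Fin n)),
        (#{M ∈ symSignFinset n | ∀ i ∈ (J ∪ S)ᶜ, ∑ j, b j * (M i j : ZMod p) = 0} : ℝ) := by
        exact_mod_cast (card_le_card hsub).trans card_biUnion_le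
    _ ≤ ∑ J ∈ powersetCard h (univ : Finset (Fin n)),
        (#(symSignFinset n) * ρ ^ (n - h - #S) : ℝ) := by
        refine sum_le_sum fun J hJ => ?_
        refine (card_orth_rows_le b S _ ?_ hρ).trans ?_
        · rw [disjoint_left]
          intro i hi hS
          exact mem_compl.1 hi (mem_union_right _ hS)
        · gcongr ?_ * ?_
          refine pow_le_pow_of_le_one hρ0 hρ1 ?_
          have h1 := card_union_le J S
          rw [(mem_powersetCard.1 hJ).2] at h1
          rw [card_compl, Fintype.card_fin]
          omega
    _ = _ := by
        rw [sum_const, card_powersetCard, card_univ, Fintype.card_fin, nsmul_eq_mul]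

/-- If all concentration probabilities of `b` exceed `α`, Halász's inequality is dominated by its
main term, even with only the relations having an index of multiplicity one. The error terms take
up at most three quarters of `α`, whence the constant `4624 = 4 * 1156`. -/
theorem fourierBound_le_uniqueRelations {p : ℕ} [Fact p.Prime] {ι : Type*} {S : Finset ι}
    {b : ι → ZMod p} (hb : ∀ j ∈ S, b j ≠ 0) {W k : ℕ} (hW0 : 1 ≤ W) (hk0 : 1 ≤ k)
    (hk : 2 * k * W ^ 2 ≤ #S) {α : ℝ} (hp : 1 / (p : ℝ) ≤ α / 4)
    (hexp : Real.exp (-(W : ℝ) ^ 2 / 16) ≤ α / 4)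
    (htriv : 1156 * ((#S : ℝ) ^ k * k ^ (2 * k) * 2 ^ (2 * k)) ≤
      α / 4 * ((2 * #S) ^ (2 * k) * W))
    (hα : α < fourierBound S b) :
    1 ≤ #(uniqueRelations S b (2 * k)) ∧
      fourierBound S b ≤
        4624 / W * (#(uniqueRelations S b (2 * k)) / ((2 * #S) ^ (2 * k) : ℕ)) := by
  have h1 := sum_exp_le_relations hb hW0 hk0 hk
  change fourierBound S b ≤ _ at h1
  have h2 : (#(signedRelations S b (2 * k)) : ℝ) ≤ #(uniqueRelations S b (2 * k)) +
      (#S : ℝ) ^ k * k ^ (2 * k) * 2 ^ (2 * k) := by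
    exact_mod_cast card_signedRelations_le S b hk0
  have hW1 : 1 ≤ W ^ 2 := Nat.one_le_pow _ _ hW0
  have hS : 0 < #S := by nlinarith
  have hs : (0 : ℝ) < #S := by exact_mod_cast hS
  have hw : (0 : ℝ) < W := by exact_mod_cast hW0
  set X : ℝ := (2 * #S) ^ (2 * k)
  have hX : 0 < X := by positivity
  set R : ℝ := ((#(signedRelations S b (2 * k)) : ℕ) : ℝ)
  set U : ℝ := ((#(uniqueRelations S b (2 * k)) : ℕ) : ℝ)
  have h3 : 1156 * R / (X * W) ≤ 1156 * U / (X * W) + α / 4 := by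
    rw [← sub_le_iff_le_add', ← sub_div, div_le_iff₀ (by positivity)]
    linarith
  have hα0 : 0 < α := by
    have := Real.exp_pos (-(W : ℝ) ^ 2 / 16)
    linarith
  have h4 : α / 4 < 1156 * U / (X * W) := by linarith
  constructor
  · by_contra! h0
    have : U = 0 := by simp only [U]; exact_mod_cast Nat.lt_one_iff.1 h0
    rw [this] at h4
    simp at h4
    linarith
  · have h5 : 4624 / (W : ℝ) * (U / ((2 * #S) ^ (2 * k) : ℕ)) = 4 * (1156 * U / (X * W)) := by
      push_cast
      simp only [X]
      field_simp
      ring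
    rw [h5]
    linarith

/-- The union bound over all vectors modulo `p`: the first term accounts for vectors with at most
`s` non-zero entries, the second for the others. -/
theorem probSymSign_compl_orthEvent_le {p n : ℕ} [Fact p.Prime] (hp2 : p ≠ 2) {α β : ℝ}
    {h s k W : ℕ} (hβ : β * n < h + 1) (hhs : h + s ≤ n) (hW : 4624 ≤ W) (hk0 : 1 ≤ k)
    (hk : 2 * k * W ^ 2 ≤ s) (hp : 1 / (p : ℝ) ≤ α / 4)
    (hexp : Real.exp (-(W : ℝ) ^ 2 / 16) ≤ α / 4)
    (htriv : 1156 * ((s : ℝ) ^ k * k ^ (2 * k) * 2 ^ (2 * k)) ≤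
      α / 4 * ((2 * s) ^ (2 * k) * W)) :
    probSymSign n (orthEvent n α β)ᶜ ≤
      n.choose h * (n.choose s * p ^ s * (1 / 2) ^ (n - h - 1) +
        2 ^ n * ((4624 / W) ^ (n - h - s) * ((2 * s) ^ (2 * k)) ^ h * p ^ s)) := by
  classical
  have hα0 : 0 < α := by
    have := Real.exp_pos (-(W : ℝ) ^ 2 / 16)
    linarith
  have hs1 : 1 ≤ s := by
    have : 1 ≤ W ^ 2 := Nat.one_le_pow _ _ (by omega)
    nlinarith
  have hw : (0 : ℝ) < W := by exact_mod_cast (show 0 < W by omega)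
  rw [probSymSign_eq, div_le_iff₀ (by exact_mod_cast card_symSignFinset_pos n)]
  set bad : Finset (Fin n → ZMod p) := {b | b ≠ 0 ∧ ∀ S, α < fourierBound S b}
  set E : (Fin n → ZMod p) → Finset (Matrix (Fin n) (Fin n) ℤ) := fun b =>
    {M ∈ symSignFinset n | #(nonOrthRows M b) ≤ h}
  set supp : (Fin n → ZMod p) → Finset (Fin n) := fun b => {i | b i ≠ 0}
  set small := (powersetCard s (univ : Finset (Fin n))).biUnion fun D =>
    {b ∈ supportedIn (G := ZMod p) (Fin n) D | b ≠ 0}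
  have hcover : ({M ∈ symSignFinset n | M ∈ (orthEvent n α β)ᶜ} : Finset _) ⊆
      small.biUnion E ∪ (univ : Finset (Finset (Fin n))).biUnion fun D =>
        ({b ∈ bad | supp b = D ∧ s ≤ #D}).biUnion E := by
    intro M hM
    obtain ⟨hM, hMo⟩ := mem_filter.1 hM
    simp only [orthEvent, Set.mem_compl_iff, Set.mem_ofPred_eq, not_forall, not_le] at hMo
    obtain ⟨a, ha, hrows, μ, h0, h1, hlt⟩ := hMo
    obtain ⟨b, hb0, hbS, hbM⟩ := exists_zmod_vector hp2 ha h0 h1 hα0.le hlt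
    have hME : M ∈ E b := by
      refine mem_filter.2 ⟨hM, ?_⟩
      have h2 : (#(nonOrthRows M b) : ℝ) + numOrthRows M a ≤ n := by exact_mod_cast hbM M
      have h3 : (#(nonOrthRows M b) : ℝ) < (h + 1 : ℕ) := by push_cast; linarith
      exact Nat.lt_succ_iff.1 (by exact_mod_cast h3)
    rw [mem_union]
    rcases le_or_gt s #(supp b) with hsb | hsb
    · right
      rw [mem_biUnion]
      refine ⟨supp b, mem_univ _, mem_biUnion.2 ⟨b, ?_, hME⟩⟩
      simp [bad, hb0, hbS, hsb]
    · left
      obtain ⟨D, hD, hDc⟩ := exists_superset_card_eq hsb.le (by rw [Fintype.card_fin]; omega)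
      refine mem_biUnion.2 ⟨b, mem_biUnion.2 ⟨D, mem_powersetCard.2 ⟨subset_univ _, hDc⟩, ?_⟩, hME⟩
      refine mem_filter.2 ⟨mem_supportedIn.2 fun i hi => ?_, hb0⟩
      by_contra hbi
      exact hi (hD (mem_filter.2 ⟨mem_univ _, hbi⟩))
  have hsmall : ((#(small.biUnion E) : ℕ) : ℝ) ≤ n.choose s * p ^ s *
      (n.choose h * (#(symSignFinset n) * (1 / 2) ^ (n - h - 1))) := by
    have hcard : (#small : ℝ) ≤ n.choose s * p ^ s := by
      have h1 : #small ≤ ∑ D ∈ powersetCard s (univ : Finset (Fin n)), p ^ s := by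
        refine card_biUnion_le.trans (sum_le_sum fun D hD => ?_)
        refine (card_filter_le _ _).trans ?_
        rw [card_supportedIn, ZMod.card, (mem_powersetCard.1 hD).2]
      rw [sum_const, card_powersetCard, card_univ, Fintype.card_fin, smul_eq_mul] at h1
      exact_mod_cast h1
    have hE : ∀ b ∈ small, (#(E b) : ℝ) ≤
        n.choose h * (#(symSignFinset n) * (1 / 2) ^ (n - h - 1)) := by
      intro b hb
      obtain ⟨D, -, hb⟩ := mem_biUnion.1 hb
      obtain ⟨j₀, hj₀⟩ := Function.ne_iff.1 (mem_filter.1 hb).2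
      exact card_few_nonOrthRows_le b {j₀} (by omega) (by norm_num) (by norm_num)
        (card_sign_singleton_le hp2 hj₀)
    calc ((#(small.biUnion E) : ℕ) : ℝ) ≤ ∑ b ∈ small, (#(E b) : ℝ) := by
          exact_mod_cast card_biUnion_le
      _ ≤ ∑ _b ∈ small, (n.choose h * (#(symSignFinset n) * (1 / 2) ^ (n - h - 1)) : ℝ) :=
          sum_le_sum hE
      _ ≤ _ := by
          rw [sum_const, nsmul_eq_mul]
          gcongr
  have hlarge : ∀ D : Finset (Fin n),
      ((#(({b ∈ bad | supp b = D ∧ s ≤ #D}).biUnion E) : ℕ) : ℝ) ≤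
        n.choose h * (#(symSignFinset n) *
          ((4624 / W) ^ (n - h - s) * ((2 * s) ^ (2 * k)) ^ h * p ^ s)) := by
    intro D
    rcases lt_or_ge #D s with hDs | hDs
    · have : ({b ∈ bad | supp b = D ∧ s ≤ #D} : Finset (Fin n → ZMod p)) = ∅ :=
        filter_eq_empty_iff.2 fun b _ hb => by omega
      rw [this, biUnion_empty, card_empty, Nat.cast_zero]
      positivity
    set X : ℝ := (((2 * s) ^ (2 * k) : ℕ) : ℝ)
    have hX : 0 < X := by
      have : 0 < (2 * s) ^ (2 * k) := by positivity
      simp only [X]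
      exact_mod_cast this
    have hXeq : X = (2 * s : ℝ) ^ (2 * k) := by simp [X]
    have hDn : #D ≤ n := by simpa using card_le_univ D
    have hE : ∀ b ∈ ({b ∈ bad | supp b = D ∧ s ≤ #D} : Finset _), (#(E b) : ℝ) ≤
        n.choose h * (#(symSignFinset n) * ((4624 / W) ^ (n - h - s) *
          (X ^ h * ((minRelations b s (2 * k) D : ℕ) / X) ^ (#D - s)))) := by
      intro b hb
      obtain ⟨hbbad, hbD, -⟩ := mem_filter.1 hb
      obtain ⟨S, hSD, hSs, hSmin⟩ := exists_minRelations_eq b (2 * k) hDs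
      have hbS : ∀ j ∈ S, b j ≠ 0 := fun j hj => by
        have := hSD hj
        rw [← hbD] at this
        exact (mem_filter.1 this).2
      obtain ⟨hU1, hU⟩ := fourierBound_le_uniqueRelations hbS (by omega) hk0 (hSs ▸ hk) hp hexp
        (by rw [hSs]; exact htriv) ((mem_filter.1 hbbad).2.2 S)
      have hUX := card_uniqueRelations_le S b (2 * k)
      rw [hSs] at hU hUX
      rw [hSmin] at hU hU1 hUX
      change _ ≤ 4624 / (W : ℝ) * (_ / X) at hU
      set Q : ℝ := ((minRelations b s (2 * k) D : ℕ) : ℝ)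
      have hQ1 : 1 ≤ Q := by simp only [Q]; exact_mod_cast hU1
      have hQX : Q ≤ X := by simp only [Q, X]; exact_mod_cast hUX
      have hq0 : 0 < Q / X := by positivity
      have hq1 : Q / X ≤ 1 := by rw [div_le_one hX]; exact hQX
      have hδ : 4624 / (W : ℝ) ≤ 1 := by
        rw [div_le_one hw]; exact_mod_cast hW
      have hle1 : 4624 / (W : ℝ) * (Q / X) ≤ 1 := mul_le_one₀ hδ hq0.le hq1
      have hmain := card_few_nonOrthRows_le b S (h := h) (by omega)
        (ρ := 4624 / (W : ℝ) * (Q / X)) (by positivity) hle1 (fun c => by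
          have := card_sign_le_exp hp2 b S c
          rw [Fintype.card_fin] at this
          exact this.trans (mul_le_mul_of_nonneg_right hU (by positivity)))
      rw [hSs, mul_pow] at hmain
      refine hmain.trans ?_
      gcongr
      -- `h` missing factors `Q / X` are paid for by `X ^ h`, as `Q ≥ 1`
      have hXQ : 1 ≤ X * (Q / X) := by rw [mul_div_cancel₀ _ hX.ne']; exact hQ1
      calc (Q / X) ^ (n - h - s) ≤ (Q / X) ^ (n - h - s) * (X * (Q / X)) ^ h :=
            le_mul_of_one_le_right (by positivity) (one_le_pow₀ hXQ)
        _ = X ^ h * (Q / X) ^ (n - s) := by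
            rw [mul_pow, show n - s = (n - h - s) + h by omega, pow_add]; ring
        _ ≤ X ^ h * (Q / X) ^ (#D - s) := by
            gcongr ?_ * ?_
            exact pow_le_pow_of_le_one hq0.le hq1 (by omega)
    have hcount : ∑ b ∈ ({b ∈ bad | supp b = D ∧ s ≤ #D} : Finset _),
        (((minRelations b s (2 * k) D : ℕ) : ℝ) / X) ^ (#D - s) ≤ p ^ s := by
      have h1 := sum_minRelations_pow_le (G := ZMod p) (ι := Fin n) s (2 * k) (#D - s) D (by omega)
      rw [ZMod.card] at h1
      have h2 : ∑ b ∈ ({b ∈ bad | supp b = D ∧ s ≤ #D} : Finset _),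
          minRelations b s (2 * k) D ^ (#D - s) ≤
          ∑ b ∈ supportedIn (G := ZMod p) (Fin n) D, minRelations b s (2 * k) D ^ (#D - s) := by
        refine sum_le_sum_of_subset fun b hb => ?_
        rw [mem_supportedIn]
        intro i hi
        by_contra hne
        rw [← (mem_filter.1 hb).2.1] at hi
        exact hi (mem_filter.2 ⟨mem_univ _, hne⟩)
      have h3 : (∑ b ∈ ({b ∈ bad | supp b = D ∧ s ≤ #D} : Finset _),
          ((minRelations b s (2 * k) D : ℕ) : ℝ) ^ (#D - s)) ≤ X ^ (#D - s) * p ^ s := by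
        simp only [X]
        exact_mod_cast h2.trans h1
      simp_rw [div_pow]
      rw [← sum_div, div_le_iff₀ (by positivity)]
      linarith
    calc _ ≤ ∑ b ∈ ({b ∈ bad | supp b = D ∧ s ≤ #D} : Finset _), (#(E b) : ℝ) := by
          exact_mod_cast card_biUnion_le
      _ ≤ _ := sum_le_sum hE
      _ = n.choose h * (#(symSignFinset n) * ((4624 / W) ^ (n - h - s) * (X ^ h *
          ∑ b ∈ ({b ∈ bad | supp b = D ∧ s ≤ #D} : Finset _),
            (((minRelations b s (2 * k) D : ℕ) : ℝ) / X) ^ (#D - s)))) := by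
          simp_rw [mul_sum]
      _ ≤ n.choose h * (#(symSignFinset n) * ((4624 / W) ^ (n - h - s) * (X ^ h * p ^ s))) := by
          gcongr
      _ = _ := by rw [hXeq]; ring
  have hfinal : (#{M ∈ symSignFinset n | M ∈ (orthEvent n α β)ᶜ} : ℝ) ≤
      ((#(small.biUnion E) : ℕ) : ℝ) + ∑ D : Finset (Fin n),
        ((#(({b ∈ bad | supp b = D ∧ s ≤ #D}).biUnion E) : ℕ) : ℝ) := by
    exact_mod_cast (card_le_card hcover).trans
      ((card_union_le _ _).trans (Nat.add_le_add_left card_biUnion_le _))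
  have htotal := hfinal.trans (add_le_add hsmall (sum_le_sum fun D _ => hlarge D))
  refine le_trans (le_trans (le_of_eq ?_) htotal) (le_of_eq ?_)
  · congr
  rw [sum_const, card_univ, Fintype.card_finset, Fintype.card_fin, nsmul_eq_mul]
  push_cast
  ring

end

/-! ### Choice of parameters -/

section

open Finset

theorem natCast_le_two_pow {u n : ℕ} (hn : n < (u + 1) ^ 20) : n ≤ 2 ^ (20 * u) := by
  have h1 : u + 1 ≤ 2 ^ u := Nat.lt_two_pow_self
  calc n ≤ (u + 1) ^ 20 := hn.le
    _ ≤ (2 ^ u) ^ 20 := Nat.pow_le_pow_left h1 20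
    _ = _ := by rw [← pow_mul, mul_comm]

theorem mul_pow_le_pow {u : ℕ} (hu : 100000 ≤ u) (c : ℕ) {i j : ℕ} (hij : i < j)
    (hc : c ≤ 100000) : c * u ^ i ≤ u ^ j := by
  calc c * u ^ i ≤ u * u ^ i := by gcongr; omega
    _ = u ^ (i + 1) := by ring
    _ ≤ u ^ j := Nat.pow_le_pow_right (by omega) hij

theorem two_rpow_le_div_four {u : ℕ} (hu : 100000 ≤ u) {α : ℝ}
    (hα : (2 : ℝ) ^ (-((u : ℝ) ^ 6 / 100)) ≤ α) {x : ℝ} (hx : x ≤ -((u : ℝ) ^ 6 / 16)) :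
    (2 : ℝ) ^ x ≤ α / 4 := by
  have huR : (100000 : ℝ) ≤ u := by exact_mod_cast hu
  have hu6R : (100000 : ℝ) ≤ (u : ℝ) ^ 6 := huR.trans (le_self_pow₀ (by linarith) (by norm_num))
  have h1 : (2 : ℝ) ^ x ≤ (2 : ℝ) ^ (-((u : ℝ) ^ 6 / 100) + (-2)) :=
    Real.rpow_le_rpow_of_exponent_le (by norm_num) (by linarith)
  rw [Real.rpow_add (by norm_num)] at h1
  have h2 : (2 : ℝ) ^ (-2 : ℝ) = 1 / 4 := by
    rw [Real.rpow_neg (by norm_num)]; norm_num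
  rw [h2] at h1
  linarith

theorem exp_neg_le_div_four {u : ℕ} (hu : 100000 ≤ u) {α : ℝ}
    (hα : (2 : ℝ) ^ (-((u : ℝ) ^ 6 / 100)) ≤ α) :
    Real.exp (-((u ^ 3 : ℕ) : ℝ) ^ 2 / 16) ≤ α / 4 := by
  have hu6R : (0 : ℝ) ≤ (u : ℝ) ^ 6 := by positivity
  refine le_trans ?_ (two_rpow_le_div_four hu hα (le_refl (-((u : ℝ) ^ 6 / 16))))
  rw [Real.rpow_def_of_pos (by norm_num)]
  apply Real.exp_le_exp.2
  have h1 : Real.log 2 ≤ 1 := Real.log_two_lt_d9.le.trans (by norm_num)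
  push_cast
  nlinarith

/-- Relations without an index of multiplicity one make up a proportion `(k² / s) ^ k = 2 ^ (-k)`
of all signed sequences for `k = u ^ 6` and `s = 2 * u ^ 12`. -/
theorem trivial_relations_le {u : ℕ} (hu : 100000 ≤ u) {α : ℝ}
    (hα : (2 : ℝ) ^ (-((u : ℝ) ^ 6 / 100)) ≤ α) :
    1156 * (((2 * u ^ 12 : ℕ) : ℝ) ^ u ^ 6 * ((u ^ 6 : ℕ) : ℝ) ^ (2 * u ^ 6) * 2 ^ (2 * u ^ 6)) ≤
      α / 4 * ((2 * ((2 * u ^ 12 : ℕ) : ℝ)) ^ (2 * u ^ 6) * ((u ^ 3 : ℕ) : ℝ)) := by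
  have huR : (100000 : ℝ) ≤ u := by exact_mod_cast hu
  have hα0 : 0 < α := lt_of_lt_of_le (by positivity) hα
  have h1 : (1 : ℝ) / 2 ^ (u ^ 6) ≤ α / 4 / 1156 * u ^ 3 := by
    have hu6 : (0 : ℝ) ≤ (u : ℝ) ^ 6 := by positivity
    have h2 := two_rpow_le_div_four hu hα (x := -((u : ℝ) ^ 6)) (by linarith)
    rw [Real.rpow_neg (by norm_num), ← Nat.cast_pow u 6, Real.rpow_natCast] at h2
    have h3 : (1156 : ℝ) ≤ u ^ 3 := by nlinarith [pow_le_pow_left₀ (by norm_num) huR 3]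
    rw [one_div]
    refine h2.trans ?_
    rw [div_mul_eq_mul_div, le_div_iff₀ (by norm_num)]
    gcongr
  generalize hk : u ^ 6 = k at *
  have h4 : (2 * ((2 * u ^ 12 : ℕ) : ℝ)) ^ (2 * k) =
      ((2 * u ^ 12 : ℕ) : ℝ) ^ k * ((k : ℕ) : ℝ) ^ (2 * k) * 2 ^ (2 * k) * 2 ^ k := by
    have h5 : ((2 * u ^ 12 : ℕ) : ℝ) = 2 * (k : ℝ) ^ 2 := by
      rw [← hk]; push_cast; ring
    rw [h5, mul_pow, mul_pow, mul_pow]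
    ring
  rw [h4]
  rw [div_le_iff₀ (by positivity)] at h1
  push_cast at h1 ⊢
  set Y : ℝ := (2 * (u : ℝ) ^ 12) ^ k * (k : ℝ) ^ (2 * k) * 2 ^ (2 * k)
  have hY : 0 ≤ Y := by positivity
  calc 1156 * Y = (1156 * Y) * 1 := by ring
    _ ≤ (1156 * Y) * (α / 4 / 1156 * u ^ 3 * 2 ^ k) := by gcongr
    _ = _ := by ring

/-- For `u ≈ n ^ (1 / 20)` and `p ≈ 2 ^ u ^ 6` all entropy terms of the union bound are
`2 ^ O(u ^ 18)`, which is negligible compared to `2 ^ n`. -/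
theorem union_bound_le {u n p : ℕ} (hu : 100000 ≤ u) (hn : u ^ 20 ≤ n)
    (hn' : n < (u + 1) ^ 20) (hp2 : p ≤ 2 * 2 ^ u ^ 6) :
    (n.choose (u ^ 6) : ℝ) * (n.choose (2 * u ^ 12) * p ^ (2 * u ^ 12) *
      (1 / 2) ^ (n - u ^ 6 - 1) + 2 ^ n * ((4624 / ((u ^ 3 : ℕ) : ℝ)) ^ (n - u ^ 6 - 2 * u ^ 12) *
        ((2 * ((2 * u ^ 12 : ℕ) : ℝ)) ^ (2 * u ^ 6)) ^ u ^ 6 * p ^ (2 * u ^ 12))) ≤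
      2 ^ (11 * u ^ 18) / 2 ^ n := by
  have huR : (100000 : ℝ) ≤ u := by exact_mod_cast hu
  have hu0 : (0 : ℝ) < u := by linarith
  have hpowle := fun c {i j : ℕ} => mul_pow_le_pow hu c (i := i) (j := j)
  obtain ⟨B, hB⟩ : ∃ B, B = u ^ 18 := ⟨_, rfl⟩
  rw [← hB]
  have hB1 : 20 * u ^ 7 ≤ B := hB ▸ hpowle 20 (by norm_num) (by norm_num)
  have hB2 : 40 * u ^ 13 ≤ B := hB ▸ hpowle 40 (by norm_num) (by norm_num)
  have hB3 : 2 * u ^ 6 ≤ B := hB ▸ hpowle 2 (by norm_num) (by norm_num)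
  have hB4 : 4 * u ^ 12 ≤ B := hB ▸ hpowle 4 (by norm_num) (by norm_num)
  have hB5 : 20 * B ≤ n := hB ▸ (hpowle 20 (by norm_num) (by norm_num)).trans hn
  have hu6 : 1 ≤ u ^ 6 := Nat.one_le_pow _ _ (by omega)
  have hn2 : (n : ℝ) ≤ 2 ^ (20 * u) := by exact_mod_cast natCast_le_two_pow hn'
  clear hn'
  have two_le : ∀ {i j : ℕ}, i ≤ j → (2 : ℝ) ^ i ≤ 2 ^ j := fun hij =>
    pow_le_pow_right₀ (by norm_num) hij
  have hchoose : ∀ i : ℕ, (n.choose i : ℝ) ≤ 2 ^ (20 * u * i) := by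
    intro i
    calc (n.choose i : ℝ) ≤ (n : ℝ) ^ i := by exact_mod_cast Nat.choose_le_pow n i
      _ ≤ (2 ^ (20 * u)) ^ i := pow_le_pow_left₀ (by positivity) hn2 i
      _ = 2 ^ (20 * u * i) := (pow_mul _ _ _).symm
  have t1 : (n.choose (u ^ 6) : ℝ) ≤ 2 ^ B := by
    have h1 : 20 * u * u ^ 6 ≤ B := le_of_eq_of_le (by ring) hB1
    exact (hchoose _).trans (two_le h1)
  have t2 : (n.choose (2 * u ^ 12) : ℝ) ≤ 2 ^ B := by
    have h1 : 20 * u * (2 * u ^ 12) ≤ B := le_of_eq_of_le (by ring) hB2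
    exact (hchoose _).trans (two_le h1)
  have t3 : (p : ℝ) ^ (2 * u ^ 12) ≤ 2 ^ (4 * B) := by
    have h1 : (p : ℝ) ≤ 2 ^ (u ^ 6 + 1) := by
      rw [pow_succ, mul_comm]; exact_mod_cast hp2
    calc (p : ℝ) ^ (2 * u ^ 12) ≤ (2 ^ (u ^ 6 + 1)) ^ (2 * u ^ 12) := by gcongr
      _ = 2 ^ ((u ^ 6 + 1) * (2 * u ^ 12)) := by rw [← pow_mul]
      _ ≤ _ := two_le (by
        calc (u ^ 6 + 1) * (2 * u ^ 12) ≤ (2 * u ^ 6) * (2 * u ^ 12) := by gcongr; omega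
          _ = 4 * B := by rw [hB]; ring)
  have t4 : (1 / 2 : ℝ) ^ (n - u ^ 6 - 1) ≤ 2 ^ B / 2 ^ n := by
    rw [one_div, inv_pow, inv_eq_one_div, div_le_div_iff₀ (by positivity) (by positivity), one_mul,
      ← pow_add]
    exact two_le (by omega)
  have t5 : (4624 / ((u ^ 3 : ℕ) : ℝ)) ^ (n - u ^ 6 - 2 * u ^ 12) ≤ 2 ^ (4 * B) / 2 ^ (4 * n) := by
    have h1 : 4624 / ((u ^ 3 : ℕ) : ℝ) ≤ (1 / 2) ^ 4 := by
      rw [div_le_iff₀ (by positivity)]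
      push_cast
      nlinarith [pow_le_pow_left₀ (by norm_num) huR 3]
    calc _ ≤ ((1 / 2 : ℝ) ^ 4) ^ (n - u ^ 6 - 2 * u ^ 12) := by gcongr
      _ = (1 / 2) ^ (4 * (n - u ^ 6 - 2 * u ^ 12)) := by rw [← pow_mul]
      _ ≤ _ := by
        rw [one_div, inv_pow, inv_eq_one_div, div_le_div_iff₀ (by positivity) (by positivity),
          one_mul, ← pow_add]
        exact two_le (by omega)
  have t6 : ((2 * ((2 * u ^ 12 : ℕ) : ℝ)) ^ (2 * u ^ 6)) ^ u ^ 6 ≤ 2 ^ B := by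
    have h1 : 2 * ((2 * u ^ 12 : ℕ) : ℝ) ≤ 2 ^ (13 * u) := by
      have h2 : 4 * u ^ 12 ≤ 2 ^ (13 * u) := by
        calc 4 * u ^ 12 ≤ u ^ 13 := hpowle 4 (by norm_num) (by norm_num)
          _ ≤ (2 ^ u) ^ 13 := Nat.pow_le_pow_left Nat.lt_two_pow_self.le 13
          _ = _ := by rw [← pow_mul, mul_comm]
      have h3 : 2 * (2 * u ^ 12) ≤ 2 ^ (13 * u) := by linarith
      exact_mod_cast h3
    calc _ ≤ ((2 ^ (13 * u) : ℝ) ^ (2 * u ^ 6)) ^ u ^ 6 := by gcongr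
      _ = 2 ^ (26 * u ^ 13) := by rw [← pow_mul, ← pow_mul]; congr 1; ring
      _ ≤ _ := two_le (by omega)
  calc _ ≤ (2 : ℝ) ^ B * (2 ^ B * 2 ^ (4 * B) * (2 ^ B / 2 ^ n) +
        2 ^ n * (2 ^ (4 * B) / 2 ^ (4 * n) * 2 ^ B * 2 ^ (4 * B))) := by gcongr
    _ = 2 ^ (7 * B) / 2 ^ n + 2 ^ (10 * B) / 2 ^ n / 2 ^ (2 * n) := by
        field_simp
        ring
    _ ≤ 2 ^ (10 * B) / 2 ^ n + 2 ^ (10 * B) / 2 ^ n :=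
        add_le_add (div_le_div_of_nonneg_right (two_le (by omega)) (by positivity))
          (div_le_self (by positivity) (one_le_pow₀ (by norm_num)))
    _ = 2 ^ (10 * B + 1) / 2 ^ n := by ring
    _ ≤ _ := by
        gcongr
        · norm_num
        · omega

theorem probSymSign_compl_orthEvent_le_rpow {u n : ℕ} (hu : 100000 ≤ u) (hn : u ^ 20 ≤ n)
    (hn' : n < (u + 1) ^ 20) {α β : ℝ} (hα : (2 : ℝ) ^ (-((u : ℝ) ^ 6 / 100)) ≤ α)
    (hβ : β * n < (u : ℝ) ^ 6 + 1) :
    probSymSign n (orthEvent n α β)ᶜ ≤ (2 : ℝ) ^ (-((n : ℝ) / 32)) := by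
  obtain ⟨p, hprime, hp1, hp2⟩ := Nat.exists_prime_lt_and_le_two_mul (2 ^ u ^ 6) (by positivity)
  have : Fact p.Prime := ⟨hprime⟩
  have hu6 : 1 ≤ u ^ 6 := Nat.one_le_pow _ _ (by omega)
  have hu3 := mul_pow_le_pow hu 4624 (show 0 < 3 by norm_num) (by norm_num)
  rw [pow_zero, mul_one] at hu3
  have hu12 := mul_pow_le_pow hu 4 (show 12 < 20 by norm_num) (by norm_num)
  have hu20 := mul_pow_le_pow hu 4 (show 6 < 20 by norm_num) (by norm_num)
  have hp2' : p ≠ 2 := by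
    have : 2 ^ 1 ≤ 2 ^ u ^ 6 := Nat.pow_le_pow_right (by norm_num) hu6
    omega
  have hpα : 1 / (p : ℝ) ≤ α / 4 := by
    have hx : -((u : ℝ) ^ 6) ≤ -((u : ℝ) ^ 6 / 16) := by
      linarith [show (0 : ℝ) ≤ (u : ℝ) ^ 6 by positivity]
    refine le_trans ?_ (two_rpow_le_div_four hu hα hx)
    rw [one_div, Real.rpow_neg (by norm_num), ← Nat.cast_pow u 6, Real.rpow_natCast]
    have h1 : ((2 : ℝ) ^ u ^ 6) ≤ p := by exact_mod_cast hp1.le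
    gcongr
  have hk : 2 * u ^ 6 * (u ^ 3) ^ 2 ≤ 2 * u ^ 12 := le_of_eq (by ring)
  have h := probSymSign_compl_orthEvent_le (n := n) (β := β) hp2' (h := u ^ 6)
    (by exact_mod_cast hβ) (by omega) (by omega) hu6 hk hpα
    (exp_neg_le_div_four hu hα) (trivial_relations_le hu hα)
  refine (h.trans (union_bound_le hu hn hn' hp2)).trans ?_
  rw [← Real.rpow_natCast, ← Real.rpow_natCast, ← Real.rpow_sub (by norm_num)]
  apply Real.rpow_le_rpow_of_exponent_le (by norm_num)
  have h18 := (mul_pow_le_pow hu 20 (show 18 < 20 by norm_num) (by norm_num)).trans hn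
  have : (20 : ℝ) * (u : ℝ) ^ 18 ≤ n := by exact_mod_cast h18
  push_cast
  linarith

end

theorem theorem3p2 :
    ∃ N : ℕ, ∀ n : ℕ, N ≤ n →
      probSymSign n
        (orthEvent n
          ((2 : ℝ) ^ (-((n : ℝ) ^ (1 / 4 : ℝ) * √(Real.log n) / 64)))
          ((n : ℝ) ^ (-(3 / 4) : ℝ) * √(Real.log n) / 128))ᶜ
      ≤ (2 : ℝ) ^ (-((n : ℝ) / 32)) := by
  refine ⟨100000 ^ 20, fun n hn => ?_⟩
  have hnR : (100000 : ℝ) ^ 20 ≤ n := by exact_mod_cast hn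
  have hn0 : (0 : ℝ) < n := lt_of_lt_of_le (by positivity) hnR
  set v : ℝ := (n : ℝ) ^ (1 / 20 : ℝ)
  have hv0 : 0 ≤ v := by positivity
  have hv : v ^ 20 = n := by
    rw [← Real.rpow_natCast, ← Real.rpow_mul hn0.le]; norm_num
  have hv5 : (n : ℝ) ^ (1 / 4 : ℝ) = v ^ 5 := by
    rw [← Real.rpow_natCast, ← Real.rpow_mul hn0.le]; norm_num
  set u := ⌊v⌋₊
  have huv : (u : ℝ) ≤ v := Nat.floor_le hv0
  have hvu : v < u + 1 := Nat.lt_floor_add_one v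
  have hu : 100000 ≤ u := by
    rw [Nat.le_floor_iff hv0]
    push_cast
    refine le_of_pow_le_pow_left₀ (n := 20) (by norm_num) hv0 ?_
    rw [hv]; exact hnR
  have huR : (100000 : ℝ) ≤ u := by exact_mod_cast hu
  have hn1 : u ^ 20 ≤ n := by
    have : (u : ℝ) ^ 20 ≤ n := hv ▸ pow_le_pow_left₀ (by positivity) huv 20
    exact_mod_cast this
  have hn2 : n < (u + 1) ^ 20 := by
    have : (n : ℝ) < ((u : ℝ) + 1) ^ 20 := hv ▸ pow_lt_pow_left₀ hvu hv0 (by norm_num)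
    exact_mod_cast this
  have hlog : √(Real.log n) ≤ u / 50 := by
    rw [Real.sqrt_le_left (by positivity), ← hv, Real.log_pow]
    have h1 : Real.log v ≤ v - 1 := Real.log_le_sub_one_of_pos (by linarith)
    have h2 : 100000 * (u : ℝ) ≤ u * u := mul_le_mul_of_nonneg_right huR (by positivity)
    push_cast
    linarith [show ((u : ℝ) / 50) ^ 2 = u * u / 2500 by ring]
  have hL : (n : ℝ) ^ (1 / 4 : ℝ) * √(Real.log n) ≤ 16 / 25 * (u : ℝ) ^ 6 := by
    rw [hv5]
    calc v ^ 5 * √(Real.log n) ≤ (2 * u) ^ 5 * (u / 50) := by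
          gcongr; linarith
      _ = _ := by ring
  refine probSymSign_compl_orthEvent_le_rpow hu hn1 hn2 ?_ ?_
  · apply Real.rpow_le_rpow_of_exponent_le (by norm_num)
    linarith
  · have h1 : (n : ℝ) ^ (-(3 / 4) : ℝ) * n = (n : ℝ) ^ (1 / 4 : ℝ) := by
      rw [← Real.rpow_add_one hn0.ne']; norm_num
    have h2 : (n : ℝ) ^ (-(3 / 4) : ℝ) * √(Real.log n) / 128 * n =
        (n : ℝ) ^ (1 / 4 : ℝ) * √(Real.log n) / 128 := by rw [← h1]; ring
    rw [h2]
    have : (0 : ℝ) ≤ (u : ℝ) ^ 6 := by positivity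
    linarith
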